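/- Let $K$ be a number field, Galois over $\mathbb{Q}$, of degree $n=[K:\mathbb{Q}]$, and let $\gamma_1,\dots,\gamma_n$ be a fixed $\mathbb{Z}$-basis of its ring of integers $\mathcal{O}_K$; write $[\alpha]\in\mathbb{Z}^n$ for the coordinate vector of $\alpha\in\mathcal{O}_K$ in this basis. For $\mathbf a_1,\mathbf b_1,\mathbf a_2,\mathbf b_2\in\mathbb{Z}^n$ such that all entries $b_{i,j}$ of $\mathbf b_1,\mathbf b_2$ are positive, let $\mathscr B$ be the set of models $E_{\alpha,\beta}\colon Y^2=X^3+\alpha X+\beta$ with $\alpha,\beta\in\mathcal{O}_K$, $\mathbf a_1-\mathbf b_1\le[\alpha]\le\mathbf a_1+\mathbf b_1$ and $\mathbf a_2-\mathbf b_2\le[\beta]\le\mathbf a_2+\mathbf b_2$ (entrywise inequalities), and put $$\mathscr V(\mathscr B)=2^{2n}\prod_{j=1}^n b_{1,j}b_{2,j},\qquad \mathscr V_i(\mathscr B)=2^n\prod_{j=1}^n b_{i,j}\ (i=1,2),\qquad \mathscr V_{\min}(\mathscr B)=2\min_{1\le j\le n}\{b_{1,j},b_{2,j}\}.$$ Let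 $\mathfrak p$ be a degree-$1$ prime of $K$ with $\mathfrak p\nmid 6\prod_{j=1}^n\gamma_j$, let $p$ be the rational prime below $\mathfrak p$, and let $E_{a,b}\colon Y^2=X^3+aX+b$ be an elliptic curve over $\mathcal{O}_K/\mathfrak p\cong\mathbb{F}_p$. Let $\#\mathrm{Aut}_p(E_{a,b})$ be the number of automorphisms of $E_{a,b}$ over $\mathbb{F}_p$. Then $$\#\mathrm{Aut}_p(E_{a,b})=\begin{cases}2&\text{if }ab\neq0,\\ \gcd(4,p-1)&\text{if }a\ne0,\ b=0,\\ \gcd(6,p-1)&\text{if }a=0,\ b\neq0.\end{cases}$$ Let $\mathscr B(E_{a,b},\mathfrak p)$ be the set of models in $\mathscr B$ whose reduction modulo $\mathfrak p$ is isomorphic to $E_{a,b}$ over $\mathcal{O}_K/\mathfrak p$. If $K\ne\mathbb{Q}$ or $ab\neq0$, then $$\#\mathscr B(E_{a,b},\mathfrak p)=\frac{p-1}{p^2\,\#\mathrm{Aut}_p(E_{a,b})}\mathscr V(\mathscr B)+O\!\left(\frac{\mathscr V(\mathscr B)}{p\,\mathscr V_{\min}(\mathscr B)}+\bigl(\mathscr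 V_1(\mathscr B)+\mathscr V_2(\mathscr B)\bigr)p^{n-3/2}(\log p)^n+p^{2n-3/2}(\log p)^{2n}\right),$$ where the implied constant depends only on $K$ and the basis $\gamma_1,\dots,\gamma_n$; in particular it is uniform in $\mathfrak p$, $a$, $b$ and $\mathbf a_1,\mathbf b_1,\mathbf a_2,\mathbf b_2$. -/

import Mathlib

open NumberField

noncomputable section

namespace CurveBox

/-- The model `E_{a,b} : Y² = X³ + aX + b` over a commutative ring. -/
def shortModel {R : Type*} [CommRing R] (a b : R) : WeierstrassCurve R :=
  ⟨0, 0, 0, a, b⟩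

/-- Two Weierstrass curves over `R` are isomorphic over `R` if an admissible change of
variables `(X, Y) ↦ (u²X + r, u³Y + u²sX + t)`, with `u` a unit of `R` and `r, s, t ∈ R`,
carries one to the other. -/
def Isomorphic {R : Type*} [CommRing R] (W W' : WeierstrassCurve R) : Prop :=
  ∃ C : WeierstrassCurve.VariableChange R, C • W = W'

/-- The number of automorphisms over `R` of a Weierstrass curve: the admissible changes of
variables over `R` that fix it. -/
def autCount {R : Type*} [CommRing R] (W : WeierstrassCurve R) : ℕ :=
  Nat.card (MulAction.stabilizer (WeierstrassCurve.VariableChange R) W)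

variable {K : Type*} [Field K] [NumberField K]

/-- The box of algebraic integers whose coordinate vector `c` with respect to the integral
basis `γ` satisfies `a - b ≤ c ≤ a + b` entrywise. -/
def intBox (γ : Module.Basis (Fin (Module.finrank ℚ K)) ℤ (𝓞 K))
    (a b : Fin (Module.finrank ℚ K) → ℤ) : Set (𝓞 K) :=
  {α | ∀ j, a j - b j ≤ γ.repr α j ∧ γ.repr α j ≤ a j + b j}

/-- The box of models `E_{α,β}`, with `α` and `β` in the boxes given by `(a₁, b₁)` and
`(a₂, b₂)`. Distinct pairs `(α, β)` are distinct models. -/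
def modelBox (γ : Module.Basis (Fin (Module.finrank ℚ K)) ℤ (𝓞 K))
    (a₁ b₁ a₂ b₂ : Fin (Module.finrank ℚ K) → ℤ) : Set (WeierstrassCurve (𝓞 K)) :=
  {W | ∃ α ∈ intBox γ a₁ b₁, ∃ β ∈ intBox γ a₂ b₂, W = shortModel α β}

/-- The models in the box whose reduction modulo `P` is isomorphic over `𝓞 K ⧸ P` to `E`. -/
def modelsReducingTo (γ : Module.Basis (Fin (Module.finrank ℚ K)) ℤ (𝓞 K))
    (a₁ b₁ a₂ b₂ : Fin (Module.finrank ℚ K) → ℤ) (P : Ideal (𝓞 K))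
    (E : WeierstrassCurve (𝓞 K ⧸ P)) : Set (WeierstrassCurve (𝓞 K)) :=
  {W | W ∈ modelBox γ a₁ b₁ a₂ b₂ ∧ Isomorphic (W.map (Ideal.Quotient.mk P)) E}

/-- `2ⁿ ∏ⱼ bⱼ`; this is `𝒱₁` for `b = b₁` and `𝒱₂` for `b = b₂`. -/
def vol {n : ℕ} (b : Fin n → ℤ) : ℝ :=
  2 ^ n * ∏ j, (b j : ℝ)

/-- `𝒱 = 2²ⁿ ∏ⱼ b₁ⱼ b₂ⱼ`. -/
def volTotal {n : ℕ} (b₁ b₂ : Fin n → ℤ) : ℝ :=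
  2 ^ (2 * n) * ∏ j, ((b₁ j : ℝ) * (b₂ j : ℝ))

/-- `𝒱_min = 2 minⱼ {b₁ⱼ, b₂ⱼ}` (a minimum over the nonempty finite index set when `n ≥ 1`). -/
def volMin {n : ℕ} (b₁ b₂ : Fin n → ℤ) : ℝ :=
  2 * ⨅ j, min (b₁ j : ℝ) (b₂ j : ℝ)

end CurveBox

end

/-!
Over the residue field `𝔽_p`, the isomorphisms between short Weierstrass models are the scalings
`(a, b) ↦ (u⁴ a, u⁶ b)`, so the product of `#Aut` and the number of models is the number of triples
consisting of a unit `u` and a point in each box whose reductions are `u⁴ a` and `u⁶ b`. Fourier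
analysis on `𝔽_p²` turns the deviation of this count from its mean into sums over nonzero
frequencies of box sums times `∑ u, ψ (h u⁴ a + k u⁶ b)`. The `ℓ¹`-norm of the Fourier transform of
an interval is `O(p log p)`, which gives one factor `log p` for each coordinate.

For `a b ≠ 0` the sums over `u` are `O(√p)` by Weil's bound. The latter is proved by Stepanov's
method for the curves `yᵖ - y = f(x)` over the extensions of `𝔽_p` of large even degree, with a
constant that does not matter: over all extensions the exponential sums are minus the power sums of
the inverse zeros of an `L`-function, and such a growth estimate bounds each inverse zero by `√p`.

For `a b = 0` and `n ≥ 2` a sum over `u` may be as large as `p`. The lost `√p` is recovered in the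
box sums: no nonzero multiple of the vector of the `γⱼ` modulo `𝔭` has all its coordinates much
smaller than `√p`. Indeed, let `φ : 𝓞 K → ℤ` be the linear form with these coordinates. Modulo `p`
the matrix `φ (γᵢ γⱼ)` has rank one, while each pair of rows has a nonzero minor over `ℤ`, which
therefore is at least `p` in absolute value.
-/

section ArtinSchreier

open Polynomial

variable {k : Type*} [Field k] {p : ℕ} {f : k[X]}

/-- The Artin–Schreier polynomial `Y ^ p - Y - f` over `k[X]`. -/
noncomputable def artinSchreierPoly (p : ℕ) (f : k[X]) : k[X][X] :=
  X ^ p - (X + C f)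

theorem degree_X_add_C_lt_natCast (hp : 1 < p) (f : k[X]) :
    degree (X + C f : k[X][X]) < (p : WithBot ℕ) := by
  rw [degree_X_add_C]
  exact_mod_cast hp

theorem monic_artinSchreierPoly (hp : 1 < p) (f : k[X]) : (artinSchreierPoly p f).Monic :=
  monic_X_pow_sub (degree_X_add_C_lt_natCast hp f)

theorem degree_artinSchreierPoly (hp : 1 < p) (f : k[X]) :
    (artinSchreierPoly p f).degree = p := by
  rw [artinSchreierPoly, degree_sub_eq_left_of_degree_lt, degree_X_pow]
  rw [degree_X_pow]
  exact degree_X_add_C_lt_natCast hp f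

/-- The coordinate ring `k[x, y]` of the affine Artin–Schreier curve `y ^ p - y = f(x)`. -/
abbrev ArtinSchreierRing (p : ℕ) (f : k[X]) := AdjoinRoot (artinSchreierPoly p f)

namespace ArtinSchreierRing

variable (p f) in
/-- The monomial `x ^ i * y ^ j`, where `j` may exceed `p - 1`. -/
noncomputable def monomial (i j : ℕ) : ArtinSchreierRing p f :=
  AdjoinRoot.of _ (X ^ i) * AdjoinRoot.root _ ^ j

theorem monomial_mul_monomial (i j i' j' : ℕ) :
    monomial p f i j * monomial p f i' j' = monomial p f (i + i') (j + j') := by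
  simp only [monomial, pow_add, map_mul]
  ring

@[simp]
theorem monomial_zero_zero : monomial p f 0 0 = 1 := by
  simp [monomial]

theorem root_pow_eq : (AdjoinRoot.root (artinSchreierPoly p f)) ^ p
    = AdjoinRoot.root _ + AdjoinRoot.of _ f := by
  have h : eval₂ (AdjoinRoot.of (artinSchreierPoly p f)) (AdjoinRoot.root _)
      (X ^ p - (X + C f)) = 0 := AdjoinRoot.eval₂_root (artinSchreierPoly p f)
  rw [eval₂_sub, eval₂_add, eval₂_X_pow, eval₂_X, eval₂_C] at h
  exact sub_eq_zero.mp h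

theorem of_eq_sum_smul (q : k[X][X]) (f : k[X]) :
    AdjoinRoot.of q f
      = ∑ l ∈ Finset.range (f.natDegree + 1), f.coeff l • AdjoinRoot.of q (X ^ l) := by
  conv_lhs => rw [f.as_sum_range_C_mul_X_pow, map_sum]
  simp only [AdjoinRoot.smul_of, smul_eq_C_mul]

theorem monomial_add_exponent (i j : ℕ) :
    monomial p f i (j + p) = monomial p f i (j + 1)
      + ∑ l ∈ Finset.range (f.natDegree + 1), f.coeff l • monomial p f (i + l) j := by
  have hsum : monomial p f i j * AdjoinRoot.of _ f
      = ∑ l ∈ Finset.range (f.natDegree + 1), f.coeff l • monomial p f (i + l) j := by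
    rw [of_eq_sum_smul, Finset.mul_sum]
    refine Finset.sum_congr rfl fun l _ => ?_
    rw [monomial, monomial, mul_smul_comm, pow_add, map_mul, mul_right_comm]
  rw [← hsum]
  simp only [monomial, pow_add, root_pow_eq, pow_one]
  ring

variable (p f) in
/-- The span of the monomials of weight less than `w`, where `x` has weight `p` and `y` has
weight `deg f`. For `deg f` prime to `p` these weights are the pole orders at the unique point
at infinity of the curve. -/
noncomputable def weightLT (w : ℕ) : Submodule k (ArtinSchreierRing p f) :=
  Submodule.span k {z | ∃ i j, p * i + f.natDegree * j < w ∧ z = monomial p f i j}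

theorem monomial_mem_weightLT {i j w : ℕ} (h : p * i + f.natDegree * j < w) :
    monomial p f i j ∈ weightLT p f w :=
  Submodule.subset_span ⟨i, j, h, rfl⟩

theorem weightLT_mono {w w' : ℕ} (h : w ≤ w') : weightLT p f w ≤ weightLT p f w' := by
  apply Submodule.span_mono
  rintro z ⟨i, j, hij, rfl⟩
  exact ⟨i, j, hij.trans_le h, rfl⟩

theorem mul_mem_weightLT {u v : ArtinSchreierRing p f} {w w' : ℕ}
    (hu : u ∈ weightLT p f (w + 1)) (hv : v ∈ weightLT p f w') :
    u * v ∈ weightLT p f (w + w') := by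
  have h := Submodule.mul_mem_mul hu hv
  rw [weightLT, weightLT, Submodule.span_mul_span] at h
  refine Submodule.span_le.mpr ?_ h
  rintro _ ⟨_, ⟨i, j, hij, rfl⟩, _, ⟨i', j', hij', rfl⟩, rfl⟩
  change monomial p f i j * monomial p f i' j' ∈ _
  rw [monomial_mul_monomial]
  refine monomial_mem_weightLT ?_
  rw [mul_add, mul_add]
  omega

theorem pow_mem_weightLT {u : ArtinSchreierRing p f} {w : ℕ} (hu : u ∈ weightLT p f (w + 1))
    (n : ℕ) : u ^ n ∈ weightLT p f (n * w + 1) := by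
  induction n with
  | zero => simpa using monomial_mem_weightLT (p := p) (f := f) (i := 0) (j := 0) one_pos
  | succ n ih =>
    rw [pow_succ', Nat.succ_mul, add_comm (n * w) w, add_assoc]
    exact mul_mem_weightLT hu ih

/-- `z` is a nonzero multiple of a monomial of weight `w` up to terms of smaller weight. -/
def HasLeadingWeight (z : ArtinSchreierRing p f) (w : ℕ) : Prop :=
  ∃ c : k, c ≠ 0 ∧ ∃ i j, p * i + f.natDegree * j = w ∧ z - c • monomial p f i j ∈ weightLT p f w

theorem HasLeadingWeight.mem_weightLT {z : ArtinSchreierRing p f} {w : ℕ}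
    (h : HasLeadingWeight z w) : z ∈ weightLT p f (w + 1) := by
  obtain ⟨c, -, i, j, hij, hz⟩ := h
  have hmon : c • monomial p f i j ∈ weightLT p f (w + 1) :=
    Submodule.smul_mem _ c (monomial_mem_weightLT (by omega))
  simpa using Submodule.add_mem _ (weightLT_mono (Nat.le_succ w) hz) hmon

theorem hasLeadingWeight_smul_monomial {c : k} (hc : c ≠ 0) (i j : ℕ) :
    HasLeadingWeight (c • monomial p f i j) (p * i + f.natDegree * j) :=
  ⟨c, hc, i, j, rfl, by simp⟩

theorem hasLeadingWeight_monomial (i j : ℕ) :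
    HasLeadingWeight (monomial p f i j) (p * i + f.natDegree * j) := by
  simpa using hasLeadingWeight_smul_monomial (p := p) (f := f) (one_ne_zero (α := k)) i j

theorem HasLeadingWeight.mul {z z' : ArtinSchreierRing p f} {w w' : ℕ}
    (h : HasLeadingWeight z w) (h' : HasLeadingWeight z' w') :
    HasLeadingWeight (z * z') (w + w') := by
  have hz := h.mem_weightLT
  obtain ⟨c, hc, i, j, hij, hlow⟩ := h
  obtain ⟨c', hc', i', j', hij', hlow'⟩ := h'
  refine ⟨c * c', mul_ne_zero hc hc', i + i', j + j', by rw [← hij, ← hij']; ring, ?_⟩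
  have hsplit : z * z' - (c * c') • monomial p f (i + i') (j + j')
      = z * (z' - c' • monomial p f i' j')
        + (c' • monomial p f i' j') * (z - c • monomial p f i j) := by
    simp only [← monomial_mul_monomial, Algebra.smul_def, map_mul]
    ring
  rw [hsplit]
  refine Submodule.add_mem _ (mul_mem_weightLT hz hlow') ?_
  rw [add_comm w]
  exact mul_mem_weightLT (Submodule.smul_mem _ _ (monomial_mem_weightLT (by omega))) hlow

theorem HasLeadingWeight.pow {z : ArtinSchreierRing p f} {w : ℕ} (h : HasLeadingWeight z w)
    (n : ℕ) : HasLeadingWeight (z ^ n) (n * w) := by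
  induction n with
  | zero => simpa using hasLeadingWeight_monomial (p := p) (f := f) 0 0
  | succ n ih =>
    rw [pow_succ, Nat.succ_mul]
    exact ih.mul h

theorem HasLeadingWeight.add {z z' : ArtinSchreierRing p f} {w : ℕ} (h : HasLeadingWeight z w)
    (h' : z' ∈ weightLT p f w) : HasLeadingWeight (z + z') w := by
  obtain ⟨c, hc, i, j, hij, hlow⟩ := h
  refine ⟨c, hc, i, j, hij, ?_⟩
  rw [add_sub_right_comm]
  exact Submodule.add_mem _ hlow h'

theorem exists_hasLeadingWeight_sum {ι : Type*} [Fintype ι] {z : ι → ArtinSchreierRing p f}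
    {w : ι → ℕ} (hz : z ≠ 0) (hw : Set.InjOn w (Function.support z))
    (h : ∀ i, z i ≠ 0 → HasLeadingWeight (z i) (w i)) :
    ∃ i, z i ≠ 0 ∧ HasLeadingWeight (∑ i, z i) (w i) := by
  classical
  obtain ⟨i, hi, hmax⟩ := Set.exists_max_image (Function.support z) w (Set.toFinite _)
    (Function.support_nonempty_iff.mpr hz)
  refine ⟨i, hi, ?_⟩
  rw [← Finset.add_sum_erase _ z (Finset.mem_univ i)]
  refine (h i hi).add (Submodule.sum_mem _ fun j hj => ?_)
  by_cases hzj : z j = 0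
  · exact hzj ▸ Submodule.zero_mem _
  · have hlt : w j < w i :=
      (hmax j hzj).lt_of_ne fun e => Finset.ne_of_mem_erase hj (hw hzj hi e)
    exact weightLT_mono hlt (h j hzj).mem_weightLT

/-- The coordinates of an element in the `k[x]`-basis `1, y, …, y ^ (p - 1)`, encoded as the
coefficients of a polynomial of degree less than `p` over `k[x]`. -/
noncomputable def coord (hp : 1 < p) : ArtinSchreierRing p f →ₗ[k[X]] k[X][X] :=
  AdjoinRoot.modByMonicHom (monic_artinSchreierPoly hp f)

theorem mk_coord (hp : 1 < p) (z : ArtinSchreierRing p f) :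
    AdjoinRoot.mk _ (coord hp z) = z :=
  AdjoinRoot.mk_leftInverse (monic_artinSchreierPoly hp f) z

theorem coord_injective (hp : 1 < p) : Function.Injective (coord (f := f) hp) :=
  (AdjoinRoot.mk_leftInverse (monic_artinSchreierPoly hp f)).injective

theorem degree_coord_lt (hp : 1 < p) (z : ArtinSchreierRing p f) :
    (coord hp z).degree < (p : WithBot ℕ) := by
  obtain ⟨g, rfl⟩ := AdjoinRoot.mk_surjective z
  rw [coord, AdjoinRoot.modByMonicHom_mk, ← degree_artinSchreierPoly hp f]
  exact degree_modByMonic_lt _ (monic_artinSchreierPoly hp f)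

theorem coord_monomial (hp : 1 < p) (i : ℕ) {j : ℕ} (hj : j < p) :
    coord hp (monomial p f i j) = C (X ^ i) * X ^ j := by
  have hmk : monomial p f i j = AdjoinRoot.mk _ (C (X ^ i) * X ^ j) := by
    simp [monomial]
  rw [hmk, coord, AdjoinRoot.modByMonicHom_mk,
    modByMonic_eq_self_iff (monic_artinSchreierPoly hp f), degree_artinSchreierPoly hp]
  exact (degree_C_mul_X_pow_le _ _).trans_lt (by exact_mod_cast hj)

theorem coord_smul (hp : 1 < p) (c : k) (z : ArtinSchreierRing p f) :
    coord hp (c • z) = c • coord hp z := by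
  rw [← algebraMap_smul k[X] c z, map_smul, algebraMap_smul]

theorem coeff_coord_monomial_of_lt (hp : 1 < p) {i j i' j' : ℕ}
    (h : p * i' + f.natDegree * j' < p * i + f.natDegree * j) :
    ((coord hp (monomial p f i' j')).coeff j).coeff i = 0 := by
  induction j' using Nat.strong_induction_on generalizing i' with
  | _ j' ih =>
    rcases lt_or_ge j' p with hlt | hge
    · rw [coord_monomial hp _ hlt, coeff_C_mul_X_pow]
      split_ifs with hj
      · subst hj
        rw [coeff_X_pow, if_neg]
        rintro rfl
        omega
      · simp only [coeff_zero]
    · obtain ⟨m, rfl⟩ := Nat.exists_eq_add_of_le' hge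
      have hfirst : ((coord hp (monomial p f i' (m + 1))).coeff j).coeff i = 0 :=
        ih (m + 1) (by omega) (lt_of_le_of_lt (by gcongr) h)
      have hrest : ∀ l ∈ Finset.range (f.natDegree + 1),
          f.coeff l • ((coord hp (monomial p f (i' + l) m)).coeff j).coeff i = 0 := by
        intro l hl
        have hmul := Nat.mul_le_mul_left p (Nat.lt_succ_iff.mp (Finset.mem_range.mp hl))
        rw [ih m (by omega) (by
          rw [mul_add] at h ⊢
          rw [mul_comm f.natDegree p] at h
          omega), smul_zero]
      rw [monomial_add_exponent]
      simp only [map_add, map_sum, coord_smul, coeff_add, finsetSum_coeff, coeff_smul]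
      rw [hfirst, Finset.sum_eq_zero hrest, add_zero]

theorem coeff_coord_eq_zero (hp : 1 < p) {w : ℕ} {z : ArtinSchreierRing p f}
    (hz : z ∈ weightLT p f w) {i j : ℕ} (hij : w ≤ p * i + f.natDegree * j) :
    ((coord hp z).coeff j).coeff i = 0 := by
  induction hz using Submodule.span_induction with
  | mem z h =>
    obtain ⟨i', j', h', rfl⟩ := h
    exact coeff_coord_monomial_of_lt hp (h'.trans_le hij)
  | zero => simp
  | add a b _ _ iha ihb => simp [iha, ihb]
  | smul c a _ iha => rw [coord_smul, coeff_smul, coeff_smul, iha, smul_zero]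

theorem monomial_sub_leadingCoeff_smul_monomial_mem (hp : 1 < p) (hd : 0 < f.natDegree)
    (i j : ℕ) : monomial p f i (j + p) - f.leadingCoeff • monomial p f (i + f.natDegree) j ∈
      weightLT p f (p * i + f.natDegree * (j + p)) := by
  rw [monomial_add_exponent, Finset.sum_range_succ, ← add_assoc, leadingCoeff, add_sub_cancel_right]
  refine Submodule.add_mem _ (monomial_mem_weightLT (by gcongr))
    (Submodule.sum_mem _ fun l hl => Submodule.smul_mem _ _ (monomial_mem_weightLT ?_))
  have := Nat.mul_lt_mul_of_pos_left (Finset.mem_range.mp hl) (show 0 < p by omega)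
  rw [mul_add, mul_add, mul_comm _ p]
  omega

theorem monomial_notMem_weightLT (hp : 1 < p) (hd : 0 < f.natDegree) (i j : ℕ) :
    monomial p f i j ∉ weightLT p f (p * i + f.natDegree * j) := by
  induction j using Nat.strong_induction_on generalizing i with
  | _ j ih =>
    rcases lt_or_ge j p with hlt | hge
    · intro h
      have hcoeff := coeff_coord_eq_zero hp h le_rfl
      rw [coord_monomial hp _ hlt, coeff_C_mul_X_pow, if_pos rfl, coeff_X_pow, if_pos rfl] at hcoeff
      exact one_ne_zero hcoeff
    · obtain ⟨m, rfl⟩ := Nat.exists_eq_add_of_le' hge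
      have hlead : f.leadingCoeff ≠ 0 :=
        leadingCoeff_ne_zero.mpr (ne_zero_of_natDegree_gt hd)
      have hweight : p * i + f.natDegree * (m + p) = p * (i + f.natDegree) + f.natDegree * m := by
        ring
      intro h
      have hred := Submodule.sub_mem _ h (monomial_sub_leadingCoeff_smul_monomial_mem hp hd i m)
      rw [sub_sub_cancel, Submodule.smul_mem_iff _ hlead, hweight] at hred
      exact ih m (by omega) _ hred

theorem HasLeadingWeight.ne_zero (hp : 1 < p) (hd : 0 < f.natDegree)
    {z : ArtinSchreierRing p f} {w : ℕ} (h : HasLeadingWeight z w) : z ≠ 0 := by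
  rintro rfl
  obtain ⟨c, hc, i, j, rfl, h⟩ := h
  rw [zero_sub, Submodule.neg_mem_iff, Submodule.smul_mem_iff _ hc] at h
  exact monomial_notMem_weightLT hp hd i j h

theorem charP [CharP k p] (hp : 1 < p) (hd : 0 < f.natDegree) :
    CharP (ArtinSchreierRing p f) p := by
  have : Nontrivial (ArtinSchreierRing p f) :=
    ⟨_, _, (hasLeadingWeight_monomial 0 0).ne_zero hp hd⟩
  exact charP_of_injective_algebraMap (algebraMap k (ArtinSchreierRing p f)).injective p

theorem eq_of_coeff_coord_eq (hp : 1 < p) {D : ℕ} {z z' : ArtinSchreierRing p f}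
    (hz : z ∈ weightLT p f (p * D)) (hz' : z' ∈ weightLT p f (p * D))
    (h : ∀ (j : Fin p) (i : Fin D),
      ((coord hp z).coeff j).coeff i = ((coord hp z').coeff j).coeff i) : z = z' := by
  apply coord_injective hp
  ext j i
  rcases lt_or_ge j p with hj | hj
  · rcases lt_or_ge i D with hi | hi
    · exact h ⟨j, hj⟩ ⟨i, hi⟩
    · have hle : p * D ≤ p * i + f.natDegree * j :=
        (Nat.mul_le_mul_left p hi).trans (Nat.le_add_right _ _)
      rw [coeff_coord_eq_zero hp hz hle, coeff_coord_eq_zero hp hz' hle]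
  · have hzero : ∀ z : ArtinSchreierRing p f, (coord hp z).coeff j = 0 := fun z =>
      coeff_eq_zero_of_degree_lt ((degree_coord_lt hp z).trans_le (by exact_mod_cast hj))
    rw [hzero, hzero]

theorem natDegree_coeff_coord_lt (hp : 1 < p) {N j : ℕ} {z : ArtinSchreierRing p f}
    (hz : z ∈ weightLT p f (p * N)) (hj : (coord hp z).coeff j ≠ 0) :
    ((coord hp z).coeff j).natDegree < N := by
  by_contra! hle
  have hlead := coeff_coord_eq_zero hp hz (i := ((coord hp z).coeff j).natDegree) (j := j)
    ((Nat.mul_le_mul_left p hle).trans (Nat.le_add_right _ _))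
  rw [coeff_natDegree, leadingCoeff_eq_zero] at hlead
  exact hj hlead

end ArtinSchreierRing

end ArtinSchreier

section Stepanov

open Polynomial

variable {k : Type*} [Field k] {p : ℕ} {f : k[X]}

namespace ArtinSchreierRing

theorem weight_injective (hcop : p.Coprime f.natDegree) {i i' j j' : ℕ} (hj : j < p)
    (hj' : j' < p) (h : p * i + f.natDegree * j = p * i' + f.natDegree * j') :
    i = i' ∧ j = j' := by
  have hmod : f.natDegree * j ≡ f.natDegree * j' [MOD p] := by
    simpa [Nat.ModEq] using congrArg (· % p) h
  obtain rfl : j = j' :=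
    (Nat.ModEq.cancel_left_of_coprime hcop hmod).eq_of_lt_of_lt hj hj'
  exact ⟨Nat.eq_of_mul_eq_mul_left (by omega) (Nat.add_right_cancel h), rfl⟩

variable (p f) in
/-- The element with coefficients `c` on the box of monomials `x ^ i * y ^ j`, `i < A`, `j < p`. -/
noncomputable def boxSum {A : ℕ} (c : Fin A × Fin p → k) : ArtinSchreierRing p f :=
  ∑ s, c s • monomial p f s.1 s.2

theorem boxSum_zero {A : ℕ} : boxSum p f (0 : Fin A × Fin p → k) = 0 := by
  simp [boxSum]

theorem boxSum_sub {A : ℕ} (c c' : Fin A × Fin p → k) :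
    boxSum p f (c - c') = boxSum p f c - boxSum p f c' := by
  simp [boxSum, sub_smul]

theorem box_weight_lt {A : ℕ} (s : Fin A × Fin p) :
    p * s.1 + f.natDegree * s.2 < p * (A + f.natDegree) := by
  have hx : p * (s.1 : ℕ) + p ≤ p * A := by
    rw [← Nat.mul_succ]
    exact Nat.mul_le_mul_left _ s.1.2
  have hy : f.natDegree * (s.2 : ℕ) ≤ f.natDegree * p := Nat.mul_le_mul_left _ s.2.2.le
  have hp : 0 < p := s.2.pos
  rw [mul_add, mul_comm p f.natDegree]
  omega

theorem boxSum_mem_weightLT {A : ℕ} (c : Fin A × Fin p → k) :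
    boxSum p f c ∈ weightLT p f (p * (A + f.natDegree)) :=
  Submodule.sum_mem _ fun s _ => Submodule.smul_mem _ _ (monomial_mem_weightLT (box_weight_lt s))

theorem exists_hasLeadingWeight_boxSum (hp : 1 < p) (hd : 0 < f.natDegree)
    (hcop : p.Coprime f.natDegree) {A : ℕ} {c : Fin A × Fin p → k} (hc : c ≠ 0) :
    ∃ w < p * (A + f.natDegree), HasLeadingWeight (boxSum p f c) w := by
  have hcoeff (s) (hs : c s • monomial p f (s.1 : ℕ) (s.2 : ℕ) ≠ 0) : c s ≠ 0 :=
    left_ne_zero_of_smul hs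
  obtain ⟨s₀, hs₀⟩ := Function.ne_iff.mp hc
  obtain ⟨s, -, hs⟩ := exists_hasLeadingWeight_sum
    (z := fun s => c s • monomial p f (s.1 : ℕ) (s.2 : ℕ))
    (w := fun s => p * s.1 + f.natDegree * s.2)
    (Function.ne_iff.mpr ⟨s₀, (hasLeadingWeight_smul_monomial hs₀ _ _).ne_zero hp hd⟩)
    (fun s _ s' _ h => by
      obtain ⟨hi, hj⟩ := weight_injective hcop s.2.2 s'.2.2 h
      exact Prod.ext (Fin.ext hi) (Fin.ext hj))
    (fun s hs => hasLeadingWeight_smul_monomial (hcoeff s hs) _ _)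
  exact ⟨_, box_weight_lt s, hs⟩

theorem sum_pow_mul_mem_weightLT {A B Q D : ℕ} (hA : p * (A + f.natDegree) ≤ Q)
    (hD : Q * (Q - 1) + p * (B + f.natDegree) ≤ p * D) (c : Fin B × Fin p → Fin A × Fin p → k) :
    ∑ s, boxSum p f (c s) ^ Q * monomial p f s.1 s.2 ∈ weightLT p f (p * D) := by
  refine Submodule.sum_mem _ fun s _ => ?_
  have hbox : boxSum p f (c s) ∈ weightLT p f (Q - 1 + 1) :=
    weightLT_mono (by omega) (boxSum_mem_weightLT (c s))
  exact weightLT_mono hD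
    (mul_mem_weightLT (pow_mem_weightLT hbox _) (monomial_mem_weightLT (box_weight_lt s)))

/-- Siegel's lemma over a finite field: the number of coefficients `c` exceeds the number of
conditions. Pigeonhole suffices since the sum is additive in `c`. -/
theorem exists_sum_pow_mul_eq_zero [Finite k] [CharP k p] [Fact p.Prime] (hd : 0 < f.natDegree)
    {e A B D : ℕ} (hA : p * (A + f.natDegree) ≤ p ^ e)
    (hD : p ^ e * (p ^ e - 1) + p * (B + f.natDegree) ≤ p * D) (hcard : D < A * (p * B)) :
    ∃ c : Fin B × Fin p → Fin A × Fin p → k, c ≠ 0 ∧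
      ∑ s, boxSum p f (c s) ^ p ^ e * monomial p f s.1 s.2 = 0 := by
  have hp : 1 < p := (Fact.out : p.Prime).one_lt
  have := charP (k := k) (f := f) hp hd
  have := Fintype.ofFinite k
  let Φ (c : Fin B × Fin p → Fin A × Fin p → k) : ArtinSchreierRing p f :=
    ∑ s, boxSum p f (c s) ^ p ^ e * monomial p f s.1 s.2
  have hlt : Fintype.card (Fin p → Fin D → k)
      < Fintype.card (Fin B × Fin p → Fin A × Fin p → k) := by
    simp only [Fintype.card_fun, Fintype.card_prod, Fintype.card_fin, ← pow_mul]
    refine Nat.pow_lt_pow_right (Fintype.one_lt_card (α := k)) ?_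
    calc D * p < A * (p * B) * p := by gcongr
      _ = _ := by ring
  obtain ⟨c, c', hne, heq⟩ := Fintype.exists_ne_map_eq_of_card_lt
    (fun c (j : Fin p) (i : Fin D) => ((coord hp (Φ c)).coeff j).coeff i) hlt
  have hΦ : Φ c = Φ c' :=
    eq_of_coeff_coord_eq hp (sum_pow_mul_mem_weightLT hA hD c) (sum_pow_mul_mem_weightLT hA hD c')
      fun j i => congrFun (congrFun heq j) i
  refine ⟨c - c', sub_ne_zero.mpr hne, ?_⟩
  simp only [Pi.sub_apply, boxSum_sub, sub_pow_char_pow, sub_mul, Finset.sum_sub_distrib]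
  exact sub_eq_zero.mpr hΦ

theorem sum_mul_pow_ne_zero (hp : 1 < p) (hd : 0 < f.natDegree) (hcop : p.Coprime f.natDegree)
    {A B Q : ℕ} (hA : p * (A + f.natDegree) ≤ Q) {c : Fin B × Fin p → Fin A × Fin p → k}
    (hc : c ≠ 0) : ∑ s, boxSum p f (c s) * monomial p f s.1 s.2 ^ Q ≠ 0 := by
  have hbox : ∀ s, c s ≠ 0 → ∃ w < Q, HasLeadingWeight (boxSum p f (c s)) w := fun s hs => by
    obtain ⟨w, hw, hlead⟩ := exists_hasLeadingWeight_boxSum hp hd hcop hs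
    exact ⟨w, hw.trans_le hA, hlead⟩
  choose! w hwlt hwlead using hbox
  have hterm (s) (hs : c s ≠ 0) : HasLeadingWeight
      (boxSum p f (c s) * monomial p f (s.1 : ℕ) (s.2 : ℕ) ^ Q)
      (w s + Q * (p * s.1 + f.natDegree * s.2)) :=
    (hwlead s hs).mul ((hasLeadingWeight_monomial _ _).pow Q)
  have hcoeff (s) (hs : boxSum p f (c s) * monomial p f (s.1 : ℕ) (s.2 : ℕ) ^ Q ≠ 0) :
      c s ≠ 0 := by
    contrapose! hs
    rw [hs, boxSum_zero, zero_mul]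
  obtain ⟨s₀, hs₀⟩ := Function.ne_iff.mp hc
  obtain ⟨s, -, hs⟩ := exists_hasLeadingWeight_sum
    (z := fun s => boxSum p f (c s) * monomial p f (s.1 : ℕ) (s.2 : ℕ) ^ Q)
    (Function.ne_iff.mpr ⟨s₀, (hterm s₀ hs₀).ne_zero hp hd⟩)
    (fun s hs s' hs' h => by
      have hlt := hwlt s (hcoeff s hs)
      have hdiv := congrArg (· / Q) h
      simp only [Nat.add_mul_div_left _ _ (Nat.zero_lt_of_lt hlt), Nat.div_eq_of_lt hlt,
        Nat.div_eq_of_lt (hwlt s' (hcoeff s' hs')), zero_add] at hdiv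
      obtain ⟨hi, hj⟩ := weight_injective hcop s.2.2 s'.2.2 hdiv
      exact Prod.ext (Fin.ext hi) (Fin.ext hj))
    (fun s hs => hterm s (hcoeff s hs))
  exact hs.ne_zero hp hd

theorem sum_mul_pow_mem_weightLT {A B Q : ℕ} (hQ : 0 < Q) (hA : p * (A + f.natDegree) ≤ Q)
    (c : Fin B × Fin p → Fin A × Fin p → k) :
    ∑ s, boxSum p f (c s) * monomial p f s.1 s.2 ^ Q
      ∈ weightLT p f (Q * (p * (B + f.natDegree))) := by
  refine Submodule.sum_mem _ fun s _ => ?_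
  have hlt := box_weight_lt (f := f) s
  obtain ⟨m, hm⟩ : ∃ m, p * (B + f.natDegree) = m + 1 :=
    Nat.exists_eq_add_one_of_ne_zero (by omega)
  have hbox : boxSum p f (c s) ∈ weightLT p f (Q - 1 + 1) :=
    weightLT_mono (by omega) (boxSum_mem_weightLT (c s))
  have hmon : monomial p f s.1 s.2 ∈ weightLT p f (m + 1) := monomial_mem_weightLT (hm ▸ hlt)
  refine weightLT_mono ?_ (mul_mem_weightLT hbox (pow_mem_weightLT hmon Q))
  rw [hm, Nat.mul_succ]
  omega

/-- Evaluation at a rational point of the Artin–Schreier curve. -/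
noncomputable def evalAt (x y : k) (h : y ^ p - y = f.eval x) : ArtinSchreierRing p f →+* k :=
  AdjoinRoot.lift (evalRingHom x) y (by simp [artinSchreierPoly, ← h])

theorem evalAt_eq (hp : 1 < p) {x y : k} (h : y ^ p - y = f.eval x)
    (z : ArtinSchreierRing p f) :
    evalAt x y h z = ((coord hp z).map (evalRingHom x)).eval y := by
  conv_lhs => rw [← mk_coord hp z]
  rw [evalAt, AdjoinRoot.lift_mk, eval₂_eq_eval_map]

/-- On a field with `Q ^ 2` elements `a ↦ a ^ Q` is an involution; at rational points it exchanges
the two sums. -/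
theorem evalAt_sum_mul_pow_eq_zero [Finite k] [CharP k p] [Fact p.Prime] {e : ℕ}
    (hk : Nat.card k = (p ^ e) ^ 2) {ι : Type*} {s : Finset ι} {u m : ι → ArtinSchreierRing p f}
    (hrel : ∑ i ∈ s, u i ^ p ^ e * m i = 0) {x y : k} (h : y ^ p - y = f.eval x) :
    evalAt x y h (∑ i ∈ s, u i * m i ^ p ^ e) = 0 := by
  have := Fintype.ofFinite k
  have hfrob (a : k) : (a ^ p ^ e) ^ p ^ e = a := by
    rw [← pow_mul, ← sq, ← hk, Nat.card_eq_fintype_card]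
    exact FiniteField.pow_card a
  refine eq_zero_of_pow_eq_zero (n := p ^ e) ?_
  rw [map_sum, sum_pow_char_pow, ← map_zero (evalAt x y h), ← hrel, map_sum]
  refine Finset.sum_congr rfl fun i _ => ?_
  rw [map_mul, map_mul, mul_pow, map_pow, map_pow, hfrob]

/-- With `(x, y)` the curve contains the `p` points `(x, y + n)`, and a coordinate polynomial
has degree less than `p` in `y`. -/
theorem eval_coeff_coord_eq_zero [CharP k p] [Fact p.Prime] {z : ArtinSchreierRing p f}
    (hz : ∀ x y h, evalAt x y h z = 0) {x y : k} (h : y ^ p - y = f.eval x) (j : ℕ) :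
    ((coord (Fact.out : p.Prime).one_lt z).coeff j).eval x = 0 := by
  have hp : 1 < p := (Fact.out : p.Prime).one_lt
  suffices hcoord : (coord hp z).map (evalRingHom x) = 0 by
    simpa using congrArg (fun P => coeff P j) hcoord
  have hinj : Function.Injective fun n : Fin p => y + ((n : ℕ) : k) := fun n m hnm =>
    Fin.ext (CharP.natCast_injOn_Iio k p n.2 m.2 (add_left_cancel hnm))
  refine eq_zero_of_degree_lt_of_eval_index_eq_zero Finset.univ hinj.injOn ?_ fun n _ => ?_
  · simpa using degree_map_le.trans_lt (degree_coord_lt hp z)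
  · have hn : ((n : ℕ) : k) ^ p = (n : ℕ) := map_natCast (frobenius k p) n
    have h' : (y + ((n : ℕ) : k)) ^ p - (y + ((n : ℕ) : k)) = f.eval x := by
      rw [add_pow_char, hn, ← h]
      ring
    rw [← evalAt_eq hp h', hz]

theorem ncard_le_of_evalAt_eq_zero [CharP k p] [Fact p.Prime] {N : ℕ}
    {z : ArtinSchreierRing p f} (hz0 : z ≠ 0) (hzN : z ∈ weightLT p f (p * N))
    (hz : ∀ x y h, evalAt x y h z = 0) :
    {x : k | ∃ y, y ^ p - y = f.eval x}.ncard ≤ N := by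
  classical
  have hp : 1 < p := (Fact.out : p.Prime).one_lt
  obtain ⟨j, hj⟩ : ∃ j, (coord hp z).coeff j ≠ 0 := by
    by_contra! h
    exact hz0 (coord_injective hp (by rw [map_zero]; ext1 j; simp [h j]))
  set g := (coord hp z).coeff j
  have hsub : {x : k | ∃ y, y ^ p - y = f.eval x} ⊆ g.roots.toFinset := by
    rintro x ⟨y, h⟩
    simp only [Finset.mem_coe, Multiset.mem_toFinset, mem_roots hj, IsRoot]
    exact eval_coeff_coord_eq_zero hz h j
  calc _ ≤ (g.roots.toFinset : Set k).ncard := Set.ncard_le_ncard hsub (Finset.finite_toSet _)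
    _ = g.roots.toFinset.card := Set.ncard_coe_finset _
    _ ≤ g.natDegree := (Multiset.toFinset_card_le _).trans (card_roots' g)
    _ ≤ N := (natDegree_coeff_coord_lt hp hzN hj).le

end ArtinSchreierRing

open ArtinSchreierRing in
/-- Stepanov's method: Siegel's lemma gives an auxiliary element of small weight that vanishes at
all rational points of the curve. -/
theorem ncard_artinSchreier_le [Finite k] [CharP k p] [Fact p.Prime] {e : ℕ}
    (hk : Nat.card k = (p ^ (e + 1)) ^ 2) (hd : 0 < f.natDegree) (hcop : p.Coprime f.natDegree)
    (he : f.natDegree ^ 2 + 4 * f.natDegree + 2 < 2 * p ^ e) (hde : f.natDegree ≤ p ^ e) :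
    {x : k | ∃ y, y ^ p - y = f.eval x}.ncard
      ≤ p ^ (e + 1) * (p ^ e + 2 * f.natDegree + 2) := by
  have hp : 1 < p := (Fact.out : p.Prime).one_lt
  set d := f.natDegree with hd_def
  obtain ⟨A, hA⟩ : ∃ A, p ^ e = A + d := Nat.exists_eq_add_of_le' hde
  have hQpos : 0 < p ^ (e + 1) := by positivity
  have hQ : p ^ (e + 1) = p * (A + d) := by rw [pow_succ', hA]
  have hD : p ^ (e + 1) * (p ^ (e + 1) - 1) + p * (A + 2 * d + 2 + d)
      ≤ p * ((A + d) * p ^ (e + 1) + 2 * d + 2) := by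
    zify [hQpos]
    have hQ' : (p : ℤ) ^ (e + 1) = p * (A + d) := by exact_mod_cast hQ
    rw [hQ']
    apply le_of_eq
    ring
  have hcard : (A + d) * p ^ (e + 1) + 2 * d + 2 < A * (p * (A + 2 * d + 2)) := by
    rw [hQ]
    rw [hA] at he
    nlinarith [Nat.mul_le_mul_right (2 * A - (d * d)) hp.le,
      mul_le_mul hp.le he.le (by omega) (by omega)]
  obtain ⟨c, hc, hrel⟩ := exists_sum_pow_mul_eq_zero hd hQ.ge hD hcard
  refine ncard_le_of_evalAt_eq_zero (sum_mul_pow_ne_zero hp hd hcop hQ.ge hc)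
    (weightLT_mono ?_ (sum_mul_pow_mem_weightLT hQpos hQ.ge c))
    fun x y h => evalAt_sum_mul_pow_eq_zero hk hrel h
  rw [hA, ← hd_def]
  apply le_of_eq
  ring

end Stepanov

section AdditiveHilbertNinety

open Polynomial

/-- The additive Artin–Schreier map `y ↦ y ^ p - y`. -/
def artinSchreierHom (L : Type*) [Field L] (p : ℕ) [ExpChar L p] : L →+ L :=
  (frobenius L p : L →+ L) - AddMonoidHom.id L

theorem natCard_ker_artinSchreierHom_le (L : Type*) [Field L] {p : ℕ} [ExpChar L p]
    (hp : 1 < p) : Nat.card (artinSchreierHom L p).ker ≤ p := by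
  classical
  have hne : (X ^ p - X : L[X]) ≠ 0 := FiniteField.X_pow_card_sub_X_ne_zero L hp
  have hsub : ((artinSchreierHom L p).ker : Set L) ⊆ (X ^ p - X : L[X]).roots.toFinset := by
    intro y (hy : y ^ p - y = 0)
    simp [mem_roots hne, hy]
  calc Nat.card (artinSchreierHom L p).ker
      = ((artinSchreierHom L p).ker : Set L).ncard := Nat.card_coe_set_eq _
    _ ≤ ((X ^ p - X : L[X]).roots.toFinset : Set L).ncard :=
        Set.ncard_le_ncard hsub (Finset.finite_toSet _)
    _ = (X ^ p - X : L[X]).roots.toFinset.card := Set.ncard_coe_finset _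
    _ ≤ (X ^ p - X : L[X]).natDegree := (Multiset.toFinset_card_le _).trans (card_roots' _)
    _ = p := FiniteField.X_pow_card_sub_X_natDegree_eq L hp

variable {p : ℕ} [Fact p.Prime] {L : Type*} [Field L] [Finite L] [Algebra (ZMod p) L]

theorem trace_pow_sub_eq_zero (y : L) : Algebra.trace (ZMod p) L (y ^ p - y) = 0 := by
  rw [map_sub, sub_eq_zero]
  simpa using
    Algebra.trace_eq_of_algEquiv (FiniteField.frobeniusAlgEquivOfAlgebraic (ZMod p) L) y

variable (p L) in
theorem natCard_ker_trace_mul :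
    Nat.card (Algebra.trace (ZMod p) L).toAddMonoidHom.ker * p = Nat.card L := by
  set τ := (Algebra.trace (ZMod p) L).toAddMonoidHom
  have hrange : τ.range = ⊤ :=
    AddMonoidHom.range_eq_top.mpr (Algebra.trace_surjective (ZMod p) L)
  rw [← AddSubgroup.card_mul_index τ.ker, AddSubgroup.index_ker, hrange, AddSubgroup.card_top,
    Nat.card_zmod]

/-- By counting: the image of `y ↦ y ^ p - y` is contained in the kernel of the trace, and its
own kernel has at most `p` elements. -/
theorem exists_pow_sub_eq_of_trace_eq_zero {z : L} (hz : Algebra.trace (ZMod p) L z = 0) :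
    ∃ y : L, y ^ p - y = z := by
  have hp := (Fact.out : p.Prime)
  have : CharP L p := charP_of_injective_algebraMap (algebraMap (ZMod p) L).injective p
  set φ := artinSchreierHom L p
  set τ := (Algebra.trace (ZMod p) L).toAddMonoidHom
  have hle : φ.range ≤ τ.ker := by
    rintro _ ⟨y, rfl⟩
    exact trace_pow_sub_eq_zero y
  have hcard : Nat.card τ.ker * p ≤ Nat.card φ.range * p :=
    calc Nat.card τ.ker * p = Nat.card φ.ker * Nat.card φ.range := by
          rw [natCard_ker_trace_mul, ← AddSubgroup.index_ker, AddSubgroup.card_mul_index]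
      _ ≤ p * Nat.card φ.range :=
          Nat.mul_le_mul_right _ (natCard_ker_artinSchreierHom_le L hp.one_lt)
      _ = _ := mul_comm _ _
  have heq : φ.range = τ.ker :=
    AddSubgroup.eq_of_le_of_card_ge hle (Nat.le_of_mul_le_mul_right hcard hp.pos)
  obtain ⟨y, hy⟩ : z ∈ φ.range := heq ▸ hz
  exact ⟨y, hy⟩

end AdditiveHilbertNinety

section TraceSums

open Polynomial

theorem abs_sub_le_card_mul_of_le {ι : Type*} [Fintype ι] {N : ι → ℝ} {M B : ℝ}
    (hsum : ∑ c, N c = Fintype.card ι * M) (hN : ∀ c, N c ≤ M + B) (c : ι) :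
    |N c - M| ≤ Fintype.card ι * B := by
  classical
  have hterm : M + B - N c ≤ Fintype.card ι * B := by
    calc M + B - N c ≤ ∑ c', (M + B - N c') :=
          Finset.single_le_sum (f := fun c' => M + B - N c')
            (fun c' _ => sub_nonneg.mpr (hN c')) (Finset.mem_univ c)
      _ = Fintype.card ι * B := by
          rw [Finset.sum_sub_distrib, hsum, Finset.sum_const, Finset.card_univ, nsmul_eq_mul]
          ring
  have hcard : (1 : ℝ) ≤ Fintype.card ι := by exact_mod_cast Fintype.card_pos_iff.mpr ⟨c⟩
  have hB : 0 ≤ B :=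
    nonneg_of_mul_nonneg_right ((sub_nonneg.mpr (hN c)).trans hterm) (by linarith)
  rw [abs_le]
  constructor <;> nlinarith [hN c]

/-- Only an upper bound on `N` is needed: a value far below the mean `M` would force another one
far above it. -/
theorem norm_sum_addChar_mul_le {G : Type*} [AddCommGroup G] [Fintype G] {ψ : AddChar G ℂ}
    (hψ : ψ ≠ 1) {N : G → ℝ} {M B : ℝ} (hsum : ∑ c, N c = Fintype.card G * M)
    (hN : ∀ c, N c ≤ M + B) : ‖∑ c, ψ c * N c‖ ≤ Fintype.card G ^ 2 * B := by
  have hcentre : ∑ c, ψ c * N c = ∑ c, ψ c * ((N c - M : ℝ) : ℂ) := by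
    simp only [Complex.ofReal_sub, mul_sub, Finset.sum_sub_distrib, ← Finset.sum_mul,
      AddChar.sum_eq_zero_of_ne_one hψ, zero_mul, sub_zero]
  rw [hcentre]
  calc _ ≤ ∑ c : G, ‖ψ c * ((N c - M : ℝ) : ℂ)‖ := norm_sum_le _ _
    _ ≤ ∑ _c : G, Fintype.card G * B := by
      refine Finset.sum_le_sum fun c _ => ?_
      rw [norm_mul, AddChar.norm_apply, one_mul, Complex.norm_real]
      exact abs_sub_le_card_mul_of_le hsum hN c
    _ = Fintype.card G ^ 2 * B := by
      simp only [Finset.sum_const, Finset.card_univ, nsmul_eq_mul]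
      ring

variable {p : ℕ} [Fact p.Prime] {L : Type*} [Field L] [Finite L] [Algebra (ZMod p) L]
  {f : (ZMod p)[X]} {ψ : AddChar (ZMod p) ℂ}

variable (L) in
/-- The exponential sum of `f` over a finite extension `L` of `ZMod p`, for the character of `L`
obtained from `ψ` by composition with the trace. -/
noncomputable def traceSum (ψ : AddChar (ZMod p) ℂ) (f : (ZMod p)[X]) : ℂ :=
  ∑ᶠ x : L, ψ (Algebra.trace (ZMod p) L (aeval x f))

theorem traceSum_eq_sum_fibers (ψ : AddChar (ZMod p) ℂ) (f : (ZMod p)[X]) :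
    traceSum L ψ f
      = ∑ c, ψ c * (({x : L | Algebra.trace (ZMod p) L (aeval x f) = c}.ncard : ℝ) : ℂ) := by
  classical
  have := Fintype.ofFinite L
  rw [traceSum, finsum_eq_sum_of_fintype, ← Finset.sum_fiberwise_of_maps_to
    (g := fun x : L => Algebra.trace (ZMod p) L (aeval x f)) (t := Finset.univ)
    (fun _ _ => Finset.mem_univ _)]
  refine Finset.sum_congr rfl fun c _ => ?_
  rw [Finset.sum_congr rfl (g := fun _ => ψ c)
    (fun x hx => by rw [← (Finset.mem_filter.mp hx).2]), Finset.sum_const, nsmul_eq_mul, mul_comm,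
    ← Set.ncard_coe_finset]
  simp

theorem sum_ncard_trace_eq (f : (ZMod p)[X]) :
    ∑ c, {x : L | Algebra.trace (ZMod p) L (aeval x f) = c}.ncard = Nat.card L := by
  classical
  have := Fintype.ofFinite L
  rw [Nat.card_eq_fintype_card, ← Finset.card_univ,
    Finset.card_eq_sum_card_fiberwise (f := fun x : L => Algebra.trace (ZMod p) L (aeval x f))
      (t := Finset.univ) (fun _ _ => Finset.mem_univ _)]
  refine Finset.sum_congr rfl fun c _ => ?_
  rw [← Set.ncard_coe_finset]
  simp

theorem norm_traceSum_le_natCard : ‖traceSum L ψ f‖ ≤ Nat.card L := by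
  have := Fintype.ofFinite L
  rw [traceSum, finsum_eq_sum_of_fintype]
  refine (norm_sum_le _ _).trans ?_
  simp [AddChar.norm_apply]

section EvenDegree

variable (hd : 0 < f.natDegree) (hcop : p.Coprime f.natDegree) {e : ℕ}
  (hL : Module.finrank (ZMod p) L = 2 * (e + 1))
  (he : f.natDegree ^ 2 + 4 * f.natDegree + 2 < 2 * p ^ e) (hde : f.natDegree ≤ p ^ e)

include hd hcop hL he hde

/-- If `z` has trace `c`, the fibre over `c` consists of the `x` for which the Artin–Schreier
equation `y ^ p - y = f(x) - z` is solvable. -/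
theorem ncard_trace_eq_le (c : ZMod p) :
    {x : L | Algebra.trace (ZMod p) L (aeval x f) = c}.ncard
      ≤ p ^ (e + 1) * (p ^ e + 2 * f.natDegree + 2) := by
  have : CharP L p := charP_of_injective_algebraMap (algebraMap (ZMod p) L).injective p
  obtain ⟨z, hz⟩ := Algebra.trace_surjective (ZMod p) L c
  set g := f.map (algebraMap (ZMod p) L) - C z with hg
  have hdeg : g.natDegree = f.natDegree := by
    rw [hg, natDegree_sub_C, natDegree_map]
  have hcard : Nat.card L = (p ^ (e + 1)) ^ 2 := by
    rw [← FiniteField.pow_finrank_eq_natCard p L, hL]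
    ring
  rw [← hdeg] at hd hcop he hde ⊢
  refine (Set.ncard_le_ncard (fun x hx => ?_) (Set.toFinite _)).trans
    (ncard_artinSchreier_le hcard hd hcop he hde)
  apply exists_pow_sub_eq_of_trace_eq_zero
  rw [Set.mem_ofPred_eq] at hx
  rw [hg, eval_sub, eval_C, eval_map_algebraMap, map_sub, hx, hz, sub_self]

theorem norm_traceSum_le_of_finrank_eq (hψ : ψ ≠ 1) :
    ‖traceSum L ψ f‖ ≤ p ^ 2 * ((2 * f.natDegree + 2) * (p : ℝ) ^ (e + 1)) := by
  rw [traceSum_eq_sum_fibers]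
  refine (norm_sum_addChar_mul_le hψ (M := p ^ (e + 1) * p ^ e)
    (B := (2 * f.natDegree + 2) * p ^ (e + 1)) ?_ fun c => ?_).trans_eq (by rw [ZMod.card])
  · rw [← Nat.cast_sum, sum_ncard_trace_eq, ← FiniteField.pow_finrank_eq_natCard p L, hL,
      ZMod.card]
    push_cast
    ring
  · calc _ ≤ ((p ^ (e + 1) * (p ^ e + 2 * f.natDegree + 2) : ℕ) : ℝ) := by
          exact_mod_cast ncard_trace_eq_le hd hcop hL he hde c
      _ = _ := by
          push_cast
          ring

end EvenDegree

/-- Square-root cancellation with an unspecified constant; extensions too small for Stepanov's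
bound are covered by enlarging the constant. -/
theorem exists_norm_traceSum_le_mul_pow (hψ : ψ ≠ 1) (hd : 0 < f.natDegree)
    (hcop : p.Coprime f.natDegree) :
    ∃ C : ℝ, ∀ s : ℕ, 0 < s → ‖traceSum (GaloisField p (2 * s)) ψ f‖ ≤ C * (p : ℝ) ^ s := by
  have hp1 : 1 < p := (Fact.out : p.Prime).one_lt
  have hp : (1 : ℝ) ≤ p := by exact_mod_cast hp1.le
  set E := f.natDegree ^ 2 + 4 * f.natDegree + 2 with hE
  refine ⟨max (p ^ 2 * (2 * f.natDegree + 2)) (p ^ (E + 1)), fun s hs => ?_⟩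
  obtain ⟨e, rfl⟩ := Nat.exists_eq_succ_of_ne_zero hs.ne'
  have hL := GaloisField.finrank p (n := 2 * (e + 1)) (by omega)
  rcases lt_or_ge E e with hlt | hge
  · have hpow : e < p ^ e := Nat.lt_pow_self hp1
    refine (norm_traceSum_le_of_finrank_eq hd hcop hL (by omega) (by nlinarith) hψ).trans ?_
    rw [← mul_assoc]
    gcongr
    exact le_max_left _ _
  · refine norm_traceSum_le_natCard.trans ?_
    rw [← FiniteField.pow_finrank_eq_natCard p (GaloisField p (2 * (e + 1))), hL]
    push_cast
    rw [two_mul, pow_add]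
    gcongr
    exact (pow_le_pow_right₀ hp (by omega)).trans (le_max_right _ _)

end TraceSums

section PowerSums

open Polynomial

variable {F : Type*} [Field F]

/-- Minus `T` times the logarithmic derivative of a power series in `T`. The sign is chosen so that
`1 - a * T` is sent to `∑ a ^ n * T ^ n`. -/
noncomputable def negLogDeriv (G : PowerSeries F) : PowerSeries F :=
  -(PowerSeries.X * PowerSeries.derivative F G) * G⁻¹

theorem negLogDeriv_mul_self {G : PowerSeries F} (hG : PowerSeries.constantCoeff G ≠ 0) :
    negLogDeriv G * G = -(PowerSeries.X * PowerSeries.derivative F G) := by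
  rw [negLogDeriv, mul_assoc, PowerSeries.inv_mul_cancel G hG, mul_one]

theorem eq_negLogDeriv {G N : PowerSeries F} (hG : PowerSeries.constantCoeff G ≠ 0)
    (hN : N * G = -(PowerSeries.X * PowerSeries.derivative F G)) : N = negLogDeriv G := by
  rw [negLogDeriv, ← hN, mul_assoc, PowerSeries.mul_inv_cancel G hG, mul_one]

theorem negLogDeriv_mul {G H : PowerSeries F} (hG : PowerSeries.constantCoeff G ≠ 0)
    (hH : PowerSeries.constantCoeff H ≠ 0) :
    negLogDeriv (G * H) = negLogDeriv G + negLogDeriv H := by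
  symm
  apply eq_negLogDeriv
  · rw [map_mul]
    exact mul_ne_zero hG hH
  · rw [add_mul, ← mul_assoc, negLogDeriv_mul_self hG, mul_comm G H, ← mul_assoc,
      negLogDeriv_mul_self hH, Derivation.leibniz, smul_eq_mul, smul_eq_mul]
    ring

theorem coeff_zero_negLogDeriv (G : PowerSeries F) : PowerSeries.coeff 0 (negLogDeriv G) = 0 := by
  simp [negLogDeriv]

theorem coeff_neg_X_mul_derivative (G : PowerSeries F) (n : ℕ) :
    PowerSeries.coeff n (-(PowerSeries.X * PowerSeries.derivative F G))
      = -(n * PowerSeries.coeff n G) := by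
  cases n with
  | zero => simp
  | succ n =>
    rw [map_neg, PowerSeries.coeff_succ_X_mul, PowerSeries.coeff_derivative]
    push_cast
    ring

theorem negLogDeriv_one_sub_C_mul_X (a : F) :
    negLogDeriv (1 - PowerSeries.C a * PowerSeries.X)
      = PowerSeries.C a * PowerSeries.X * PowerSeries.mk (a ^ ·) := by
  symm
  apply eq_negLogDeriv (by simp)
  have hgeom : PowerSeries.mk (a ^ ·) * (1 - PowerSeries.C a * PowerSeries.X) = 1 := by
    have h := congrArg (PowerSeries.rescale a) (PowerSeries.mk_one_mul_one_sub_eq_one F)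
    rw [map_mul, map_sub, map_one, PowerSeries.rescale_X, PowerSeries.rescale_mk] at h
    simpa only [Pi.one_apply, mul_one] using h
  rw [mul_assoc, hgeom]
  simp [mul_comm]

/-- The sum of the `n`-th powers of the roots of a monic polynomial for `n ≠ 0`, as an expression in
its coefficients. At `n = 0` the value is `0` and not the number of roots. -/
noncomputable def powSum (g : F[X]) (n : ℕ) : F :=
  PowerSeries.coeff n (negLogDeriv (g.reverse : PowerSeries F))

theorem powSum_zero (g : F[X]) : powSum g 0 = 0 :=
  coeff_zero_negLogDeriv _

theorem constantCoeff_reverse_ne_zero {g : F[X]} (hg : g ≠ 0) :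
    PowerSeries.constantCoeff (g.reverse : PowerSeries F) ≠ 0 := by
  simpa using hg

theorem powSum_mul {g h : F[X]} (hg : g ≠ 0) (hh : h ≠ 0) (n : ℕ) :
    powSum (g * h) n = powSum g n + powSum h n := by
  rw [powSum, reverse_mul_of_domain, Polynomial.coe_mul,
    negLogDeriv_mul (constantCoeff_reverse_ne_zero hg) (constantCoeff_reverse_ne_zero hh), map_add]
  rfl

theorem powSum_one (n : ℕ) : powSum (1 : F[X]) n = 0 := by
  have h := powSum_mul (one_ne_zero (α := F[X])) one_ne_zero n
  rw [mul_one] at h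
  exact left_eq_add.mp h

theorem reverse_X_sub_C (a : F) : (X - C a : F[X]).reverse = 1 - C a * X := by
  ext n
  rw [coeff_reverse, natDegree_X_sub_C]
  rcases n with _ | _ | n
  · simp [revAt_le]
  · simp [revAt_le, coeff_one]
  · rw [revAt_eq_self_of_lt (by omega)]
    simp [coeff_X, coeff_one]

theorem powSum_X_sub_C (a : F) {n : ℕ} (hn : n ≠ 0) : powSum (X - C a) n = a ^ n := by
  obtain ⟨m, rfl⟩ := Nat.exists_eq_succ_of_ne_zero hn
  have hcoe : ((1 - C a * X : F[X]) : PowerSeries F) = 1 - PowerSeries.C a * PowerSeries.X := by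
    simp
  rw [powSum, reverse_X_sub_C, hcoe, negLogDeriv_one_sub_C_mul_X, mul_assoc,
    PowerSeries.coeff_C_mul, PowerSeries.coeff_succ_X_mul, PowerSeries.coeff_mk, pow_succ']

theorem powSum_multiset_prod_X_sub_C (s : Multiset F) {n : ℕ} (hn : n ≠ 0) :
    powSum (s.map fun a => X - C a).prod n = (s.map fun a => a ^ n).sum := by
  induction s using Multiset.induction_on with
  | empty => simp [powSum_one]
  | cons a s ih =>
    rw [Multiset.map_cons, Multiset.prod_cons, powSum_mul (X_sub_C_ne_zero a)
      (monic_multiset_prod_of_monic _ _ fun a _ => monic_X_sub_C a).ne_zero, ih,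
      powSum_X_sub_C a hn, Multiset.map_cons, Multiset.sum_cons]

theorem powSum_eq_sum_roots {g : F[X]} (hg : g.Monic) (hs : g.Splits) {n : ℕ} (hn : n ≠ 0) :
    powSum g n = (g.roots.map fun a => a ^ n).sum := by
  conv_lhs => rw [hs.eq_prod_roots_of_monic hg]
  exact powSum_multiset_prod_X_sub_C _ hn

theorem powSum_eq_neg_sub_sum {g : F[X]} (hg : g.Monic) (n : ℕ) :
    powSum g n = -(n * g.reverse.coeff n)
      - ∑ i ∈ Finset.range n, powSum g i * g.reverse.coeff (n - i) := by
  have h := congrArg (PowerSeries.coeff n)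
    (negLogDeriv_mul_self (constantCoeff_reverse_ne_zero hg.ne_zero))
  rw [coeff_neg_X_mul_derivative, PowerSeries.coeff_mul,
    Finset.Nat.sum_antidiagonal_eq_sum_range_succ_mk, Finset.sum_range_succ] at h
  simp only [Polynomial.coeff_coe, Nat.sub_self, coeff_zero_reverse, hg.leadingCoeff, mul_one] at h
  rw [← h, eq_sub_iff_add_eq']
  rfl

theorem powSum_eq_neg_of_mul_coeff_reverse_eq {g : F[X]} (hg : g.Monic) {S : ℕ → F}
    (hS : ∀ m : ℕ, m * g.reverse.coeff m
      = ∑ r ∈ Finset.Icc 1 m, S r * g.reverse.coeff (m - r)) {n : ℕ} (hn : n ≠ 0) :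
    powSum g n = -S n := by
  induction n using Nat.strong_induction_on with
  | _ n ih =>
    obtain ⟨m, rfl⟩ := Nat.exists_eq_succ_of_ne_zero hn
    have hsum : ∑ i ∈ Finset.range (m + 1), powSum g i * g.reverse.coeff (m + 1 - i)
        = -∑ i ∈ Finset.Icc 1 m, S i * g.reverse.coeff (m + 1 - i) := by
      rw [Finset.range_eq_Ico, Finset.sum_eq_sum_Ico_succ_bot (by omega), powSum_zero, zero_mul,
        zero_add, ← Finset.sum_neg_distrib]
      refine Finset.sum_congr rfl fun i hi => ?_
      obtain ⟨hi1, him⟩ := Finset.mem_Icc.mp hi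
      rw [ih i (by omega) (by omega), neg_mul]
    rw [powSum_eq_neg_sub_sum hg, hsum, hS, Finset.sum_Icc_succ_top (by omega), Nat.sub_self,
      coeff_zero_reverse, hg.leadingCoeff]
    ring

theorem coeff_reverse_map {F' : Type*} [Field F'] (φ : F →+* F') (g : F[X]) (n : ℕ) :
    (g.map φ).reverse.coeff n = φ (g.reverse.coeff n) := by
  rw [coeff_reverse, coeff_reverse, natDegree_map, coeff_map]

theorem powSum_map {F' : Type*} [Field F'] (φ : F →+* F') {g : F[X]} (hg : g.Monic) (n : ℕ) :
    powSum (g.map φ) n = φ (powSum g n) := by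
  induction n using Nat.strong_induction_on with
  | _ n ih =>
    rw [powSum_eq_neg_sub_sum (hg.map φ), powSum_eq_neg_sub_sum hg, coeff_reverse_map, map_sub,
      map_neg, map_mul, map_natCast, map_sum]
    congr 1
    refine Finset.sum_congr rfl fun i hi => ?_
    rw [ih i (Finset.mem_range.mp hi), coeff_reverse_map, map_mul]

section EqualHighCoefficients

variable {g h : F[X]} (hg : g.Monic) (hh : h.Monic) {d : ℕ}
  (heq : ∀ i < d, g.reverse.coeff i = h.reverse.coeff i)

include hg hh heq

theorem powSum_eq_of_lt {i : ℕ} (hi : i < d) : powSum h i = powSum g i := by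
  induction i using Nat.strong_induction_on with
  | _ n ih =>
    rw [powSum_eq_neg_sub_sum hg, powSum_eq_neg_sub_sum hh, heq n hi]
    congr 1
    refine Finset.sum_congr rfl fun i hin => ?_
    rw [Finset.mem_range] at hin
    rw [ih i hin (hin.trans hi), heq (n - i) (by omega)]

theorem powSum_eq_sub :
    powSum h d = powSum g d - d * (h.reverse.coeff d - g.reverse.coeff d) := by
  have hsum : ∑ i ∈ Finset.range d, powSum h i * h.reverse.coeff (d - i)
      = ∑ i ∈ Finset.range d, powSum g i * g.reverse.coeff (d - i) := by
    refine Finset.sum_congr rfl fun i hi => ?_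
    rw [Finset.mem_range] at hi
    rcases Nat.eq_zero_or_pos i with rfl | hi0
    · simp [powSum_zero]
    · rw [powSum_eq_of_lt hg hh heq hi, heq (d - i) (by omega)]
  rw [powSum_eq_neg_sub_sum hg, powSum_eq_neg_sub_sum hh, hsum]
  ring

end EqualHighCoefficients

end PowerSums

section TracePowerSums

open Polynomial IntermediateField

variable {K L : Type*} [Field K] [Field L] [Algebra K L] [FiniteDimensional K L]
  [Algebra.IsSeparable K L]

theorem trace_gen_pow_eq_powSum (pb : PowerBasis K L) {n : ℕ} (hn : n ≠ 0) :
    Algebra.trace K L (pb.gen ^ n) = powSum (minpoly K pb.gen) n := by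
  classical
  let E := AlgebraicClosure K
  have hmonic := minpoly.monic (Algebra.IsSeparable.isIntegral K pb.gen)
  have hnodup : ((minpoly K pb.gen).map (algebraMap K E)).roots.Nodup :=
    nodup_roots (Polynomial.Separable.map (Algebra.IsSeparable.isSeparable K pb.gen))
  apply (algebraMap K E).injective
  rw [trace_eq_sum_embeddings E, ← powSum_map _ hmonic,
    powSum_eq_sum_roots (hmonic.map _) (IsAlgClosed.splits _) hn,
    Fintype.sum_equiv pb.liftEquiv' (fun σ => σ (pb.gen ^ n)) (fun y => (y : E) ^ n)
      (fun σ => by rw [map_pow, PowerBasis.liftEquiv'_apply_coe]),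
    Finset.sum_mem_multiset _ _ (fun y => (y : E) ^ n) (fun y => rfl),
    Finset.sum_eq_multiset_sum, Multiset.toFinset_val, aroots, Multiset.dedup_eq_self.mpr hnodup]

theorem trace_pow_eq_finrank_mul_powSum (x : L) {n : ℕ} (hn : n ≠ 0) :
    Algebra.trace K L (x ^ n) = Module.finrank K⟮x⟯ L * powSum (minpoly K x) n := by
  have hx : IsIntegral K x := Algebra.IsSeparable.isIntegral K x
  have : Algebra.IsSeparable K K⟮x⟯ := Algebra.isSeparable_tower_bot_of_isSeparable K K⟮x⟯ L
  have hgen : algebraMap K⟮x⟯ L (adjoin.powerBasis hx).gen = x := by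
    rw [adjoin.powerBasis_gen, AdjoinSimple.algebraMap_gen]
  have hpow : x ^ n = algebraMap K⟮x⟯ L ((adjoin.powerBasis hx).gen ^ n) := by
    rw [map_pow, hgen]
  rw [hpow, ← Algebra.trace_trace (S := K⟮x⟯), Algebra.trace_algebraMap, map_nsmul, nsmul_eq_mul,
    trace_gen_pow_eq_powSum _ hn, adjoin.powerBasis_gen, minpoly_gen]

end TracePowerSums

section PowerSumGrowth

theorem re_inv_one_sub_nonneg {z : ℂ} (hz : ‖z‖ ≤ 1) : 0 ≤ ((1 - z)⁻¹).re := by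
  rw [Complex.inv_re, Complex.sub_re, Complex.one_re]
  exact div_nonneg (sub_nonneg.mpr ((Complex.re_le_norm z).trans hz)) (Complex.normSq_nonneg _)

theorem hasSum_multiset_sum_pow {s : Multiset ℂ} (hs : ∀ z ∈ s, ‖z‖ < 1) :
    HasSum (fun n : ℕ => (s.map (· ^ n)).sum) (s.map fun z => (1 - z)⁻¹).sum := by
  induction s using Multiset.induction_on with
  | empty => simp
  | cons z s ih =>
    simp only [Multiset.map_cons, Multiset.sum_cons]
    exact (hasSum_geometric_of_norm_lt_one (hs z (Multiset.mem_cons_self z s))).add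
      (ih fun w hw => hs w (Multiset.mem_cons_of_mem hw))

theorem inv_one_sub_le_norm_sum_inv {s : Multiset ℂ} (hs : ∀ z ∈ s, ‖z‖ ≤ 1) {t : ℝ}
    (ht : (t : ℂ) ∈ s) : (1 - t)⁻¹ ≤ ‖(s.map fun z => (1 - z)⁻¹).sum‖ := by
  obtain ⟨u, rfl⟩ := Multiset.exists_cons_of_mem ht
  refine le_trans ?_ (Complex.re_le_norm _)
  have hu : 0 ≤ ((u.map fun z => (1 - z)⁻¹).sum).re := by
    rw [← Complex.coe_reAddGroupHom, map_multiset_sum, Multiset.map_map]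
    refine Multiset.sum_nonneg fun x hx => ?_
    obtain ⟨z, hz, rfl⟩ := Multiset.mem_map.mp hx
    exact re_inv_one_sub_nonneg (hs z (Multiset.mem_cons_of_mem hz))
  rw [Multiset.map_cons, Multiset.sum_cons, Complex.add_re, ← Complex.ofReal_one,
    ← Complex.ofReal_sub, ← Complex.ofReal_inv, Complex.ofReal_re]
  exact le_add_of_nonneg_right hu

/-- If `1` were in `s`, then `∑ z ∈ s, (1 - t * z)⁻¹` would be unbounded as `t` tends to `1` from
below; but it is the power series in `t` formed from the power sums of `s`. -/
theorem one_notMem_of_norm_sum_pow_le {s : Multiset ℂ} {ρ C : ℝ} (hρ0 : 0 ≤ ρ) (hρ1 : ρ < 1)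
    (hs : ∀ z ∈ s, ‖z‖ ≤ 1) (h : ∀ n : ℕ, 0 < n → ‖(s.map (· ^ n)).sum‖ ≤ C * ρ ^ n) :
    (1 : ℂ) ∉ s := by
  intro hone
  set D := max C (Multiset.card s)
  set B := D * (1 - ρ)⁻¹
  have hD : 0 ≤ D := (Nat.cast_nonneg _).trans (le_max_right _ _)
  have hB : 0 ≤ B := mul_nonneg hD (inv_nonneg.mpr (sub_nonneg.mpr hρ1.le))
  have hpow (n : ℕ) : ‖(s.map (· ^ n)).sum‖ ≤ D * ρ ^ n := by
    rcases Nat.eq_zero_or_pos n with rfl | hn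
    · simp [D]
    · exact (h n hn).trans (by gcongr; exact le_max_left _ _)
  have hbound {t : ℝ} (ht0 : 0 ≤ t) (ht1 : t < 1) : (1 - t)⁻¹ ≤ B := by
    have hlt : ∀ z ∈ s.map (· * (t : ℂ)), ‖z‖ < 1 := by
      intro z hz
      obtain ⟨w, hw, rfl⟩ := Multiset.mem_map.mp hz
      rw [norm_mul, Complex.norm_real, Real.norm_of_nonneg ht0]
      exact (mul_le_of_le_one_left ht0 (hs w hw)).trans_lt ht1
    have hmem : (t : ℂ) ∈ s.map (· * (t : ℂ)) := Multiset.mem_map.mpr ⟨1, hone, one_mul _⟩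
    refine (inv_one_sub_le_norm_sum_inv (fun z hz => (hlt z hz).le) hmem).trans ?_
    rw [← (hasSum_multiset_sum_pow hlt).tsum_eq]
    refine tsum_of_norm_bounded ((hasSum_geometric_of_lt_one hρ0 hρ1).mul_left D) fun n => ?_
    have hscale : ((s.map (· * (t : ℂ))).map (· ^ n)).sum = (s.map (· ^ n)).sum * t ^ n := by
      rw [Multiset.map_map, ← Multiset.sum_map_mul_right]
      simp only [Function.comp_apply, mul_pow]
    rw [hscale, norm_mul, norm_pow, Complex.norm_real, Real.norm_of_nonneg ht0]
    exact (mul_le_of_le_one_right (norm_nonneg _) (pow_le_one₀ ht0 ht1.le)).trans (hpow n)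
  have hinv : (B + 2)⁻¹ ≤ 1 := inv_le_one_of_one_le₀ (by linarith)
  have h2 := hbound (t := 1 - (B + 2)⁻¹) (by linarith)
    (sub_lt_self _ (inv_pos.mpr (by linarith)))
  rw [sub_sub_cancel, inv_inv] at h2
  linarith

theorem norm_le_of_norm_sum_pow_le {s : Multiset ℂ} {R C : ℝ} (hR : 0 ≤ R)
    (h : ∀ n : ℕ, 0 < n → ‖(s.map (· ^ n)).sum‖ ≤ C * R ^ n) {z : ℂ} (hz : z ∈ s) : ‖z‖ ≤ R := by
  classical
  obtain ⟨w, hw, hmax⟩ := s.toFinset.exists_max_image (‖·‖) ⟨z, Multiset.mem_toFinset.mpr hz⟩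
  simp only [Multiset.mem_toFinset] at hw hmax
  refine (hmax z hz).trans ?_
  by_contra! hlt
  have hw0 : 0 < ‖w‖ := hR.trans_lt hlt
  refine one_notMem_of_norm_sum_pow_le (s := s.map (· / w)) (C := C)
    (div_nonneg hR hw0.le) ((div_lt_one hw0).mpr hlt) (fun z hz => ?_) (fun n hn => ?_)
    (Multiset.mem_map.mpr ⟨w, hw, div_self (norm_pos_iff.mp hw0)⟩)
  · obtain ⟨v, hv, rfl⟩ := Multiset.mem_map.mp hz
    rw [norm_div]
    exact div_le_one_of_le₀ (hmax v hv) hw0.le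
  · have hscale : ((s.map (· / w)).map (· ^ n)).sum = (s.map (· ^ n)).sum / w ^ n := by
      rw [Multiset.map_map, ← Multiset.sum_map_div]
      simp only [Function.comp_apply, div_pow]
    rw [hscale, norm_div, norm_pow, div_pow, ← mul_div_assoc]
    exact div_le_div_of_nonneg_right (h n hn) (pow_nonneg hw0.le n)

end PowerSumGrowth

section EulerProduct

open Polynomial UniqueFactorizationMonoid

theorem sum_Icc_mul_le_eq_sum_dvd {M : Type*} [AddCommMonoid M] {d : ℕ} (hd : 0 < d) (m : ℕ)
    (f : ℕ → M) :
    ∑ k ∈ Finset.Icc 1 m with k * d ≤ m, f k = ∑ r ∈ Finset.Icc 1 m with d ∣ r, f (r / d) := by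
  refine Finset.sum_nbij' (· * d) (· / d) ?_ ?_ ?_ ?_ ?_
  · intro k hk
    simp only [Finset.mem_filter, Finset.mem_Icc] at hk ⊢
    exact ⟨⟨Nat.mul_pos hk.1.1 hd, hk.2⟩, dvd_mul_left _ _⟩
  · intro r hr
    simp only [Finset.mem_filter, Finset.mem_Icc] at hr ⊢
    rw [Nat.div_mul_cancel hr.2]
    exact ⟨⟨Nat.div_pos (Nat.le_of_dvd hr.1.1 hr.2) hd, (Nat.div_le_self r d).trans hr.1.2⟩, hr.1.2⟩
  · exact fun k _ => Nat.mul_div_cancel k hd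
  · exact fun r hr => Nat.div_mul_cancel (Finset.mem_filter.mp hr).2
  · intro k _
    rw [Nat.mul_div_cancel k hd]

variable (F : Type*) [Field F] [Finite F]

theorem finite_setOf_monic_natDegree_le (m : ℕ) :
    {g : F[X] | g.Monic ∧ g.natDegree ≤ m}.Finite := by
  have : Finite (degreeLT F (m + 1)) := Finite.of_equiv _ (degreeLTEquiv F (m + 1)).symm.toEquiv
  refine (Set.toFinite (degreeLT F (m + 1) : Set F[X])).subset fun g hg => ?_
  exact mem_degreeLT.mpr (degree_le_natDegree.trans_lt (by exact_mod_cast Nat.lt_succ_of_le hg.2))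

/-- The monic polynomials of degree `m`. -/
noncomputable def monics (m : ℕ) : Finset F[X] :=
  ((finite_setOf_monic_natDegree_le F m).subset
    (show {g : F[X] | g.Monic ∧ g.natDegree = m} ⊆ _ from fun _ h => ⟨h.1, h.2.le⟩)).toFinset

/-- The monic irreducible polynomials of degree at most `m`. -/
noncomputable def monicIrreds (m : ℕ) : Finset F[X] :=
  ((finite_setOf_monic_natDegree_le F m).subset
    (show {g : F[X] | (g.Monic ∧ g.natDegree ≤ m) ∧ Irreducible g} ⊆ _ from
      fun _ h => h.1)).toFinset

variable {F}

theorem mem_monics {m : ℕ} {g : F[X]} : g ∈ monics F m ↔ g.Monic ∧ g.natDegree = m := by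
  simp [monics]

theorem mem_monicIrreds {m : ℕ} {g : F[X]} :
    g ∈ monicIrreds F m ↔ (g.Monic ∧ g.natDegree ≤ m) ∧ Irreducible g := by
  simp [monicIrreds]

theorem monics_zero : monics F 0 = {1} := by
  ext g
  rw [mem_monics, Finset.mem_singleton]
  constructor
  · rintro ⟨hg, h0⟩
    exact hg.natDegree_eq_zero.mp h0
  · rintro rfl
    exact ⟨monic_one, natDegree_one⟩

section NormalizedFactors

variable {K : Type*} [Field K]

open Classical in
theorem monic_of_mem_normalizedFactors {g P : K[X]} (hP : P ∈ normalizedFactors g) :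
    P.Monic := by
  rw [← normalize_normalized_factor P hP]
  exact monic_normalize (irreducible_of_normalized_factor P hP).ne_zero

open Classical in
theorem pow_dvd_iff_le_count_normalizedFactors {P g : K[X]} (hP : P.Monic) (hirr : Irreducible P)
    (hg : g ≠ 0) (k : ℕ) : P ^ k ∣ g ↔ k ≤ (normalizedFactors g).count P := by
  rw [pow_dvd_iff_le_emultiplicity, emultiplicity_eq_count_normalizedFactors hirr hg,
    hP.normalize_eq_self, Nat.cast_le]

open Classical in
theorem sum_natDegree_pow_dvd {P g : K[X]} (hP : P.Monic) (hirr : Irreducible P)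
    (hg : g ≠ 0) {m : ℕ} (hgm : g.natDegree ≤ m) :
    (∑ k ∈ Finset.Icc 1 m, if P ^ k ∣ g then P.natDegree else 0)
      = (normalizedFactors g).count P * P.natDegree := by
  have hdvd := pow_dvd_iff_le_count_normalizedFactors hP hirr hg
  have hle : (normalizedFactors g).count P ≤ m := by
    have h := natDegree_le_of_dvd ((hdvd _).mpr le_rfl) hg
    rw [natDegree_pow] at h
    exact (Nat.le_mul_of_pos_right _ hirr.natDegree_pos).trans (h.trans hgm)
  have hfilter : (Finset.Icc 1 m).filter (fun k => P ^ k ∣ g)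
      = Finset.Icc 1 ((normalizedFactors g).count P) := by
    ext k
    simp only [Finset.mem_filter, Finset.mem_Icc, hdvd]
    omega
  rw [← Finset.sum_filter, Finset.sum_const, smul_eq_mul, hfilter, Nat.card_Icc,
    Nat.add_sub_cancel]

end NormalizedFactors

open Classical in
theorem natDegree_eq_sum_pow_dvd {m : ℕ} {g : F[X]} (hg : g ∈ monics F m) :
    m = ∑ P ∈ monicIrreds F m, ∑ k ∈ Finset.Icc 1 m, if P ^ k ∣ g then P.natDegree else 0 := by
  obtain ⟨hmon, hdeg⟩ := mem_monics.mp hg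
  have hg0 := hmon.ne_zero
  have hprod : (normalizedFactors g).prod = g := by
    rw [prod_normalizedFactors_eq hg0, hmon.normalize_eq_self]
  have hsub : (normalizedFactors g).toFinset ⊆ monicIrreds F m := by
    intro P hP
    rw [Multiset.mem_toFinset] at hP
    exact mem_monicIrreds.mpr ⟨⟨monic_of_mem_normalizedFactors hP,
      hdeg ▸ natDegree_le_of_dvd (dvd_of_mem_normalizedFactors hP) hg0⟩,
      irreducible_of_normalized_factor P hP⟩
  calc m = ((normalizedFactors g).map natDegree).sum := by
        rw [← natDegree_multiset_prod_of_monic _ fun P hP => monic_of_mem_normalizedFactors hP,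
          hprod, hdeg]
    _ = ∑ P ∈ (normalizedFactors g).toFinset, (normalizedFactors g).count P * P.natDegree := by
        simp only [Finset.sum_multiset_map_count, smul_eq_mul]
    _ = ∑ P ∈ monicIrreds F m, (normalizedFactors g).count P * P.natDegree := by
        refine Finset.sum_subset hsub fun P _ hP => ?_
        rw [Multiset.mem_toFinset, ← Multiset.count_eq_zero] at hP
        rw [hP, zero_mul]
    _ = _ := by
        refine Finset.sum_congr rfl fun P hP => ?_
        obtain ⟨⟨hPmon, -⟩, hirr⟩ := mem_monicIrreds.mp hP
        rw [sum_natDegree_pow_dvd hPmon hirr hg0 hdeg.le]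

/-- The sum of a function over the monic polynomials of degree `m`. -/
noncomputable def monicSum (lam : F[X] → ℂ) (m : ℕ) : ℂ :=
  ∑ g ∈ monics F m, lam g

section CompletelyMultiplicative

variable {lam : F[X] → ℂ}
  (hmul : ∀ g h : F[X], g.Monic → h.Monic → lam (g * h) = lam g * lam h)

include hmul

open Classical in
theorem sum_monics_dvd {P : F[X]} (hP : P.Monic) (m : ℕ) :
    ∑ g ∈ monics F m with P ∣ g, lam g
      = if P.natDegree ≤ m then lam P * monicSum lam (m - P.natDegree) else 0 := by
  split_ifs with hle
  · rw [monicSum, Finset.mul_sum]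
    refine Finset.sum_nbij' (· /ₘ P) (P * ·) ?_ ?_ ?_ ?_ ?_
    · intro g hg
      obtain ⟨hgm, h, rfl⟩ := Finset.mem_filter.mp hg
      obtain ⟨hmon, hdeg⟩ := mem_monics.mp hgm
      have hh : h.Monic := hP.of_mul_monic_left hmon
      rw [hP.natDegree_mul hh] at hdeg
      rw [mul_divByMonic_cancel_left h hP]
      exact mem_monics.mpr ⟨hh, by omega⟩
    · intro h hh
      obtain ⟨hmon, hdeg⟩ := mem_monics.mp hh
      rw [Finset.mem_filter, mem_monics, hP.natDegree_mul hmon]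
      exact ⟨⟨hP.mul hmon, by omega⟩, dvd_mul_right _ _⟩
    · intro g hg
      obtain ⟨-, h, rfl⟩ := Finset.mem_filter.mp hg
      rw [mul_divByMonic_cancel_left h hP]
    · exact fun h _ => mul_divByMonic_cancel_left h hP
    · intro g hg
      obtain ⟨hgm, h, rfl⟩ := Finset.mem_filter.mp hg
      rw [mul_divByMonic_cancel_left h hP, hmul P h hP (hP.of_mul_monic_left (mem_monics.mp hgm).1)]
  · rw [Finset.filter_false_of_mem, Finset.sum_empty]
    intro g hg hdvd
    obtain ⟨hmon, hdeg⟩ := mem_monics.mp hg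
    exact hle (hdeg ▸ natDegree_le_of_dvd hdvd hmon.ne_zero)

variable (hone : lam 1 = 1)

include hone

omit [Finite F] in
theorem map_pow_of_monic {P : F[X]} (hP : P.Monic) (k : ℕ) : lam (P ^ k) = lam P ^ k := by
  induction k with
  | zero => simpa only [pow_zero]
  | succ k ih => rw [pow_succ, hmul _ _ (hP.pow k) hP, ih, pow_succ]

theorem mul_monicSum_eq_sum_pow (m : ℕ) :
    m * monicSum lam m = ∑ P ∈ monicIrreds F m, ∑ k ∈ Finset.Icc 1 m with k * P.natDegree ≤ m,
      P.natDegree * lam P ^ k * monicSum lam (m - k * P.natDegree) := by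
  classical
  have hexpand : ∀ g ∈ monics F m, (m : ℂ) * lam g = ∑ P ∈ monicIrreds F m,
      ∑ k ∈ Finset.Icc 1 m, if P ^ k ∣ g then (P.natDegree : ℂ) * lam g else 0 := by
    intro g hg
    conv_lhs => rw [natDegree_eq_sum_pow_dvd hg]
    push_cast
    simp only [Finset.sum_mul, ite_mul, zero_mul]
  rw [monicSum, Finset.mul_sum, Finset.sum_congr rfl hexpand, Finset.sum_comm]
  refine Finset.sum_congr rfl fun P hP => ?_
  have hPmon := (mem_monicIrreds.mp hP).1.1
  rw [Finset.sum_comm, Finset.sum_filter]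
  refine Finset.sum_congr rfl fun k _ => ?_
  rw [← Finset.sum_filter, ← Finset.mul_sum, sum_monics_dvd hmul (hPmon.pow k), natDegree_pow,
    map_pow_of_monic hmul hone hPmon, mul_ite, mul_zero, ← mul_assoc]

/-- Coefficient comparison in the logarithmic derivative of the Euler product
`∑ lam g = ∏ (1 - lam P)⁻¹`. -/
theorem mul_monicSum_eq (m : ℕ) :
    m * monicSum lam m = ∑ r ∈ Finset.Icc 1 m,
      (∑ P ∈ monicIrreds F m with P.natDegree ∣ r,
        P.natDegree * lam P ^ (r / P.natDegree)) * monicSum lam (m - r) := by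
  rw [mul_monicSum_eq_sum_pow hmul hone]
  simp only [Finset.sum_mul, Finset.sum_filter (s := monicIrreds F m)]
  rw [Finset.sum_comm (s := Finset.Icc 1 m)]
  refine Finset.sum_congr rfl fun P hP => ?_
  rw [sum_Icc_mul_le_eq_sum_dvd (mem_monicIrreds.mp hP).2.natDegree_pos m fun k =>
    P.natDegree * lam P ^ k * monicSum lam (m - k * P.natDegree), Finset.sum_filter]
  refine Finset.sum_congr rfl fun r _ => ?_
  split_ifs with hdvd
  · rw [Nat.div_mul_cancel hdvd]
  · rw [zero_mul]

end CompletelyMultiplicative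

end EulerProduct

section LFunction

open Polynomial

theorem exists_monic_reverse_coeff_eq {R : Type*} [CommRing R] [Nontrivial R] {a : ℕ → R} {d : ℕ}
    (h0 : a 0 = 1) (ha : ∀ i > d, a i = 0) :
    ∃ h : R[X], h.Monic ∧ h.natDegree = d ∧ ∀ i, h.reverse.coeff i = a i := by
  set h : R[X] := ∑ i ∈ Finset.range (d + 1), C (a i) * X ^ (d - i)
  have hcoeff {i : ℕ} (hi : i ≤ d) : h.coeff (d - i) = a i := by
    rw [finsetSum_coeff, Finset.sum_eq_single i]
    · rw [coeff_C_mul_X_pow, if_pos rfl]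
    · intro j hj hji
      rw [Finset.mem_range] at hj
      rw [coeff_C_mul_X_pow, if_neg (by omega)]
    · intro hi'
      exact absurd (Finset.mem_range.mpr (by omega)) hi'
  have hle : h.natDegree ≤ d :=
    natDegree_sum_le_of_forall_le _ _ fun i _ =>
      (natDegree_C_mul_X_pow_le _ _).trans (Nat.sub_le d i)
  have hlead : h.coeff d = 1 := (hcoeff (Nat.zero_le d)).trans h0
  have hdeg : h.natDegree = d :=
    le_antisymm hle (le_natDegree_of_ne_zero (hlead ▸ one_ne_zero))
  refine ⟨h, monic_of_natDegree_le_of_coeff_eq_one _ hle hlead, hdeg, fun i => ?_⟩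
  rw [coeff_reverse, hdeg]
  rcases le_or_gt i d with hi | hi
  · rw [revAt_le hi, hcoeff hi]
  · rw [revAt_eq_self_of_lt hi, coeff_eq_zero_of_natDegree_lt (hdeg.trans_lt hi), ha i hi]

theorem card_filter_minpoly_eq {K L : Type*} [Field K] [Field L] [Algebra K L]
    [Fintype L] [DecidableEq K[X]] {P : K[X]} (hP : P.Monic) (hirr : Irreducible P)
    (hdvd : P.natDegree ∣ Module.finrank K L) :
    (Finset.univ.filter fun x : L => minpoly K x = P).card = P.natDegree := by
  classical
  have : Fact (Irreducible P) := ⟨hirr⟩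
  have : Module.Finite K (AdjoinRoot P) := hP.finite_adjoinRoot
  have hfinrank : Module.finrank K (AdjoinRoot P) = P.natDegree :=
    finrank_quotient_span_eq_natDegree
  have hcard := FiniteField.natCard_algHom_of_finrank_dvd (F := K) (K := AdjoinRoot P) (L := L)
    (by rwa [hfinrank])
  rw [hfinrank, Nat.card_congr (AdjoinRoot.equiv _ _ P hP.ne_zero)] at hcard
  rw [← hcard, Nat.subtype_card]
  intro x
  rw [Finset.mem_filter_univ, mem_aroots, and_iff_right hP.ne_zero]
  constructor
  · rintro rfl
    exact minpoly.aeval _ x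
  · exact fun hx => (minpoly.eq_of_irreducible_of_monic hirr hx hP).symm

variable {p : ℕ} [Fact p.Prime] {ψ : AddChar (ZMod p) ℂ} {f : (ZMod p)[X]}

/-- For `f` without constant term, the completely multiplicative function `g ↦ ψ (∑ f α)` on monic
polynomials, where `α` runs through the roots of `g`. Its Dirichlet series is the `L`-function of
the exponential sums of `f`. -/
noncomputable def twist (ψ : AddChar (ZMod p) ℂ) (f g : (ZMod p)[X]) : ℂ :=
  ψ (∑ k ∈ Finset.range (f.natDegree + 1), f.coeff k * powSum g k)

theorem twist_one : twist ψ f 1 = 1 := by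
  simp [twist, powSum_one]

theorem twist_mul (g h : (ZMod p)[X]) (hg : g.Monic) (hh : h.Monic) :
    twist ψ f (g * h) = twist ψ f g * twist ψ f h := by
  simp only [twist, powSum_mul hg.ne_zero hh.ne_zero, mul_add, Finset.sum_add_distrib,
    AddChar.map_add_eq_mul]

section ShiftedCoefficient

variable {d m : ℕ} {g : (ZMod p)[X]}

theorem add_C_mul_X_pow_mem_monics {F : Type*} [Field F] [Finite F] {g : F[X]} (hd : 0 < d)
    (hm : d ≤ m) (hg : g ∈ monics F m) (δ : F) : g + C δ * X ^ (m - d) ∈ monics F m := by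
  obtain ⟨hmon, hdeg⟩ := mem_monics.mp hg
  have hlt : (C δ * X ^ (m - d) : F[X]).degree < g.degree := by
    rw [degree_eq_natDegree hmon.ne_zero, hdeg]
    exact (degree_C_mul_X_pow_le _ _).trans_lt (by exact_mod_cast (by omega : m - d < m))
  refine mem_monics.mpr ⟨hmon.add_of_left hlt, ?_⟩
  rw [natDegree_eq_of_degree_eq (degree_add_eq_left_of_degree_lt hlt), hdeg]

theorem twist_add_C_mul_X_pow (hd : 0 < f.natDegree) (hm : f.natDegree ≤ m)
    (hg : g ∈ monics (ZMod p) m) (δ : ZMod p) :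
    twist ψ f (g + C δ * X ^ (m - f.natDegree))
      = ψ (-(f.leadingCoeff * f.natDegree * δ)) * twist ψ f g := by
  obtain ⟨hmon, hdeg⟩ := mem_monics.mp hg
  obtain ⟨hmon', hdeg'⟩ := mem_monics.mp (add_C_mul_X_pow_mem_monics hd hm hg δ)
  have hrev : ∀ i ≤ m, (g + C δ * X ^ (m - f.natDegree)).reverse.coeff i
      = g.reverse.coeff i + if i = f.natDegree then δ else 0 := by
    intro i hi
    rw [coeff_reverse, coeff_reverse, hdeg, hdeg', revAt_le hi, coeff_add, coeff_C_mul_X_pow]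
    congr 1
    exact if_congr (by omega) rfl rfl
  have heq : ∀ i < f.natDegree,
      g.reverse.coeff i = (g + C δ * X ^ (m - f.natDegree)).reverse.coeff i := by
    intro i hi
    rw [hrev i (by omega), if_neg hi.ne, add_zero]
  have htop := powSum_eq_sub hmon hmon' heq
  rw [hrev _ hm, if_pos rfl, add_sub_cancel_left] at htop
  rw [twist, twist, ← AddChar.map_add_eq_mul, Finset.sum_range_succ, Finset.sum_range_succ, htop,
    Finset.sum_congr rfl fun i hi => by
      rw [powSum_eq_of_lt hmon hmon' heq (Finset.mem_range.mp hi)], leadingCoeff]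
  congr 1
  ring

end ShiftedCoefficient

/-- Changing the coefficient of `X ^ (m - deg f)` permutes the monic polynomials of degree `m` and
multiplies the values of the twist by a root of unity that can be chosen different from `1`. -/
theorem monicSum_twist_eq_zero (hψ : ψ ≠ 1) (hd : 0 < f.natDegree)
    (hcop : p.Coprime f.natDegree) {m : ℕ} (hm : f.natDegree ≤ m) :
    monicSum (twist ψ f) m = 0 := by
  obtain ⟨c, hc⟩ := AddChar.ne_one_iff.mp hψ
  have hne : f.leadingCoeff * (f.natDegree : ZMod p) ≠ 0 := by
    refine mul_ne_zero (leadingCoeff_ne_zero.mpr (ne_zero_of_natDegree_gt hd)) ?_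
    rw [Ne, ZMod.natCast_eq_zero_iff]
    exact fun h => (Fact.out : p.Prime).one_lt.ne' (Nat.eq_one_of_dvd_coprimes hcop dvd_rfl h)
  set δ := -c / (f.leadingCoeff * (f.natDegree : ZMod p)) with hδ
  have hval : -(f.leadingCoeff * f.natDegree * δ) = c := by
    rw [hδ, mul_div_cancel₀ _ hne, neg_neg]
  have heq : ψ c * monicSum (twist ψ f) m = monicSum (twist ψ f) m := by
    rw [monicSum, Finset.mul_sum]
    refine Finset.sum_nbij' (· + C δ * X ^ (m - f.natDegree)) (· + C (-δ) * X ^ (m - f.natDegree))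
      (fun g hg => add_C_mul_X_pow_mem_monics hd hm hg δ)
      (fun g hg => add_C_mul_X_pow_mem_monics hd hm hg (-δ)) (fun g _ => ?_) (fun g _ => ?_)
      (fun g hg => by rw [twist_add_C_mul_X_pow hd hm hg, hval])
    · simp only [C_neg, neg_mul, add_neg_cancel_right]
    · simp only [C_neg, neg_mul, neg_add_cancel_right]
  by_contra h
  exact hc ((mul_eq_right₀ h).mp heq)

theorem addChar_trace_aeval_eq (h0 : f.coeff 0 = 0) {L : Type*} [Field L] [Finite L]
    [Algebra (ZMod p) L] (x : L) :
    ψ (Algebra.trace (ZMod p) L (aeval x f)) = twist ψ f (minpoly (ZMod p) x) ^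
      (Module.finrank (ZMod p) L / (minpoly (ZMod p) x).natDegree) := by
  have hfinrank : Module.finrank (IntermediateField.adjoin (ZMod p) {x}) L
      = Module.finrank (ZMod p) L / (minpoly (ZMod p) x).natDegree := by
    have hmul := Module.finrank_mul_finrank (ZMod p) (IntermediateField.adjoin (ZMod p) {x}) L
    rw [IntermediateField.adjoin.finrank (.of_finite _ x)] at hmul
    exact (Nat.div_eq_of_eq_mul_right (minpoly.natDegree_pos (.of_finite _ x)) hmul.symm).symm
  rw [twist, ← AddChar.map_nsmul_eq_pow, aeval_eq_sum_range, map_sum, Finset.smul_sum]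
  congr 1
  refine Finset.sum_congr rfl fun k _ => ?_
  rw [map_smul, smul_eq_mul]
  rcases Nat.eq_zero_or_pos k with rfl | hk
  · simp [h0]
  · rw [trace_pow_eq_finrank_mul_powSum x hk.ne', hfinrank, nsmul_eq_mul]
    ring

theorem traceSum_eq_sum_monicIrreds (h0 : f.coeff 0 = 0) {L : Type*} [Field L] [Finite L]
    [Algebra (ZMod p) L] {m : ℕ} (hm : Module.finrank (ZMod p) L ≤ m) :
    traceSum L ψ f = ∑ P ∈ monicIrreds (ZMod p) m with P.natDegree ∣ Module.finrank (ZMod p) L,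
      P.natDegree * twist ψ f P ^ (Module.finrank (ZMod p) L / P.natDegree) := by
  classical
  have := Fintype.ofFinite L
  rw [traceSum, finsum_eq_sum_of_fintype, ← Finset.sum_fiberwise_of_maps_to
    (g := fun x => minpoly (ZMod p) x)
    (t := (monicIrreds (ZMod p) m).filter fun P => P.natDegree ∣ Module.finrank (ZMod p) L)]
  · refine Finset.sum_congr rfl fun P hP => ?_
    obtain ⟨hP, hdvd⟩ := Finset.mem_filter.mp hP
    obtain ⟨⟨hmon, -⟩, hirr⟩ := mem_monicIrreds.mp hP
    rw [Finset.sum_congr rfl (g := fun _ => twist ψ f P ^ (Module.finrank (ZMod p) L / P.natDegree))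
      (fun x hx => by rw [addChar_trace_aeval_eq h0, (Finset.mem_filter.mp hx).2]),
      Finset.sum_const, card_filter_minpoly_eq hmon hirr hdvd, nsmul_eq_mul]
  · intro x _
    have hx : IsIntegral (ZMod p) x := .of_finite _ x
    have hdvd := minpoly.degree_dvd hx
    rw [Finset.mem_filter, mem_monicIrreds]
    exact ⟨⟨⟨minpoly.monic hx, (Nat.le_of_dvd Module.finrank_pos hdvd).trans hm⟩,
      minpoly.irreducible hx⟩, hdvd⟩

/-- The `L`-function is a polynomial of degree `deg f - 1`; take the inverses of its zeros. -/
theorem exists_traceSum_eq_neg_sum_pow (hψ : ψ ≠ 1) (h0 : f.coeff 0 = 0) (hd : 0 < f.natDegree)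
    (hcop : p.Coprime f.natDegree) :
    ∃ s : Multiset ℂ, Multiset.card s = f.natDegree - 1 ∧ ∀ r ≠ 0,
      traceSum (GaloisField p r) ψ f = -(s.map (· ^ r)).sum := by
  obtain ⟨h, hmon, hdeg, hrev⟩ := exists_monic_reverse_coeff_eq (a := monicSum (twist ψ f))
    (d := f.natDegree - 1) (by rw [monicSum, monics_zero, Finset.sum_singleton, twist_one])
    (fun i hi => monicSum_twist_eq_zero hψ hd hcop (by omega))
  have hpow {r : ℕ} (hr : r ≠ 0) : powSum h r = -traceSum (GaloisField p r) ψ f := by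
    refine powSum_eq_neg_of_mul_coeff_reverse_eq (S := fun r => traceSum (GaloisField p r) ψ f)
      hmon (fun m => ?_) hr
    simp only [hrev]
    rw [mul_monicSum_eq twist_mul twist_one]
    refine Finset.sum_congr rfl fun r hr => ?_
    obtain ⟨hr1, hrm⟩ := Finset.mem_Icc.mp hr
    have hfinrank := GaloisField.finrank p (n := r) (by omega)
    rw [traceSum_eq_sum_monicIrreds h0 (hfinrank.trans_le hrm), hfinrank]
  have hsplits := IsAlgClosed.splits h
  refine ⟨h.roots, hdeg ▸ hsplits.natDegree_eq_card_roots.symm, fun r hr => ?_⟩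
  rw [← powSum_eq_sum_roots hmon hsplits hr, hpow hr, neg_neg]

end LFunction

section Weil

open Polynomial

variable {p : ℕ} [Fact p.Prime] {ψ : AddChar (ZMod p) ℂ} {f : (ZMod p)[X]}

theorem traceSum_galoisField_one :
    traceSum (GaloisField p 1) ψ f = ∑ x : ZMod p, ψ (f.eval x) := by
  have := Fintype.ofFinite (GaloisField p 1)
  rw [traceSum, finsum_eq_sum_of_fintype]
  symm
  refine Fintype.sum_equiv (GaloisField.equivZmodP p).symm.toEquiv _ _ fun x => ?_
  have hx : (GaloisField.equivZmodP p).symm.toEquiv x = algebraMap (ZMod p) (GaloisField p 1) x :=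
    (GaloisField.equivZmodP p).symm.commutes x
  rw [hx, aeval_algebraMap_apply, Algebra.trace_algebraMap, GaloisField.finrank p one_ne_zero,
    one_smul, coe_aeval_eq_eval]

/-- Weil's bound over the prime field. Bounds up to a constant over all extensions of even degree
suffice, since they bound the growth of the power sums. -/
theorem norm_sum_addChar_eval_le (hψ : ψ ≠ 1) (h0 : f.coeff 0 = 0) (hd : 0 < f.natDegree)
    (hcop : p.Coprime f.natDegree) :
    ‖∑ x : ZMod p, ψ (f.eval x)‖ ≤ (f.natDegree - 1 : ℕ) * √p := by
  obtain ⟨s, hs, hpow⟩ := exists_traceSum_eq_neg_sum_pow hψ h0 hd hcop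
  obtain ⟨C, hC⟩ := exists_norm_traceSum_le_mul_pow hψ hd hcop
  have hbound : ∀ z ∈ s, ‖z‖ ≤ √p := by
    intro z hz
    have hsq : ‖z ^ 2‖ ≤ p := by
      refine norm_le_of_norm_sum_pow_le (s := s.map (· ^ 2)) (C := C) (Nat.cast_nonneg p)
        (fun n hn => ?_) (Multiset.mem_map_of_mem _ hz)
      have h := hC n hn
      rw [hpow (2 * n) (by omega), norm_neg] at h
      simpa only [Multiset.map_map, Function.comp_apply, pow_mul] using h
    exact Real.le_sqrt_of_sq_le (by rwa [norm_pow] at hsq)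
  rw [← traceSum_galoisField_one, hpow 1 one_ne_zero, norm_neg, ← hs, ← nsmul_eq_mul]
  simp only [pow_one, Multiset.map_id']
  refine (norm_multiset_sum_le s).trans ?_
  rw [← Multiset.card_map (‖·‖) s]
  refine Multiset.sum_le_card_nsmul _ _ fun y hy => ?_
  obtain ⟨z, hz, rfl⟩ := Multiset.mem_map.mp hy
  exact hbound z hz

end Weil

section IntervalSums

/-- The size `p / (2 |t|)` of an incomplete sum of an additive character at frequency `t ≠ 0`, where
`|t|` is the absolute value of the least residue. At `t = 0` the value is `0`. -/
noncomputable def freqBound {p : ℕ} (t : ZMod p) : ℝ :=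
  p / (2 * |(t.valMinAbs : ℝ)|)

theorem freqBound_nonneg {p : ℕ} (t : ZMod p) : 0 ≤ freqBound t := by
  unfold freqBound
  positivity

theorem abs_valMinAbs_pos {p : ℕ} {t : ZMod p} (ht : t ≠ 0) : 0 < |(t.valMinAbs : ℝ)| := by
  rw [abs_pos, Int.cast_ne_zero, Ne, ZMod.valMinAbs_eq_zero]
  exact ht

variable {p : ℕ} [NeZero p]

theorem abs_valMinAbs_le_half (t : ZMod p) : |(t.valMinAbs : ℝ)| ≤ p / 2 := by
  rw [← Int.cast_abs, ← Nat.cast_natAbs]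
  exact (Nat.cast_le.mpr (ZMod.natAbs_valMinAbs_le t)).trans Nat.cast_div_le

theorem norm_stdAddChar_sub_one (t : ZMod p) :
    ‖ZMod.stdAddChar t - 1‖ = 2 * |Real.sin (Real.pi * t.valMinAbs / p)| := by
  have hexp : ZMod.stdAddChar t
      = Complex.exp (Complex.I * ((2 * (Real.pi * t.valMinAbs / p) : ℝ) : ℂ)) := by
    conv_lhs => rw [← ZMod.coe_valMinAbs t]
    rw [ZMod.stdAddChar_coe]
    congr 1
    push_cast
    ring
  rw [hexp, Complex.norm_exp_I_mul_ofReal_sub_one, norm_mul, Real.norm_eq_abs, Real.norm_eq_abs,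
    abs_two, mul_div_cancel_left₀ _ two_ne_zero]

theorem le_norm_stdAddChar_sub_one (t : ZMod p) :
    4 * |(t.valMinAbs : ℝ)| / p ≤ ‖ZMod.stdAddChar t - 1‖ := by
  have hp : (0 : ℝ) < p := Nat.cast_pos.mpr (NeZero.pos p)
  have habs : |Real.pi * t.valMinAbs / p| = Real.pi * |(t.valMinAbs : ℝ)| / p := by
    rw [abs_div, abs_mul, abs_of_pos Real.pi_pos, abs_of_pos hp]
  have hsin := Real.mul_abs_le_abs_sin (x := Real.pi * t.valMinAbs / p) (by
    rw [habs, div_le_div_iff₀ hp two_pos]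
    nlinarith [Real.pi_pos, abs_valMinAbs_le_half t])
  rw [norm_stdAddChar_sub_one]
  calc _ = 2 * (2 / Real.pi * (Real.pi * |(t.valMinAbs : ℝ)| / p)) := by
        field_simp [Real.pi_ne_zero]
        ring
    _ ≤ _ := by
        rw [← habs]
        gcongr

theorem norm_sum_Icc_stdAddChar_le {t : ZMod p} (ht : t ≠ 0) (a b : ℤ) :
    ‖∑ x ∈ Finset.Icc a b, ZMod.stdAddChar (t * (x : ZMod p))‖ ≤ freqBound t := by
  have hp : (0 : ℝ) < p := Nat.cast_pos.mpr (NeZero.pos p)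
  have hv := abs_valMinAbs_pos ht
  have hlow := le_norm_stdAddChar_sub_one t
  set ζ := ZMod.stdAddChar t with hζ
  have hpos : 0 < 4 * |(t.valMinAbs : ℝ)| / p := by positivity
  have hne : ζ ≠ 1 := sub_ne_zero.mp (norm_pos_iff.mp (hpos.trans_le hlow))
  have hsum : ∑ x ∈ Finset.Icc a b, ZMod.stdAddChar (t * (x : ZMod p))
      = ZMod.stdAddChar (t * (a : ZMod p)) * ∑ i ∈ Finset.range (b + 1 - a).toNat, ζ ^ i := by
    rw [Finset.mul_sum, Int.Icc_eq_finset_map, Finset.sum_map]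
    refine Finset.sum_congr rfl fun i _ => ?_
    rw [hζ, ← AddChar.map_nsmul_eq_pow, ← AddChar.map_add_eq_mul, nsmul_eq_mul]
    congr 1
    simp only [Function.Embedding.trans_apply, Nat.castEmbedding_apply, addLeftEmbedding_apply,
      Int.cast_add, Int.cast_natCast]
    ring
  have hnum : ‖ζ ^ (b + 1 - a).toNat - 1‖ ≤ 2 := by
    refine (norm_sub_le _ _).trans ?_
    rw [norm_pow, hζ, AddChar.norm_apply, one_pow, norm_one, one_add_one_eq_two]
  rw [hsum, norm_mul, AddChar.norm_apply, one_mul, geom_sum_eq hne, norm_div]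
  calc _ ≤ 2 / (4 * |(t.valMinAbs : ℝ)| / p) := by gcongr
    _ = freqBound t := by
        rw [freqBound]
        field_simp
        ring

theorem freqBound_le_inv_val_add {t : ZMod p} (ht : t ≠ 0) :
    freqBound t ≤ p / 2 * ((t.val : ℝ)⁻¹ + ((-t).val : ℝ)⁻¹) := by
  have : NeZero t := ⟨ht⟩
  have hmin : t.valMinAbs.natAbs = min t.val (-t).val :=
    (ZMod.valMinAbs_natAbs_eq_min t).trans (by rw [ZMod.val_neg_of_ne_zero])
  rw [freqBound, div_mul_eq_div_div, div_eq_mul_inv (p / 2 : ℝ), ← Int.cast_abs,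
    ← Nat.cast_natAbs, hmin]
  gcongr
  rcases min_choice t.val (-t).val with h | h <;> rw [h]
  · exact le_add_of_nonneg_right (by positivity)
  · exact le_add_of_nonneg_left (by positivity)

theorem sum_inv_val_le (p : ℕ) [NeZero p] :
    ∑ t : ZMod p with t ≠ 0, (t.val : ℝ)⁻¹ ≤ 1 + Real.log p := by
  calc _ ≤ ∑ k ∈ Finset.Icc 1 p, (k : ℝ)⁻¹ := by
        rw [← Finset.sum_image (g := ZMod.val) (f := fun k : ℕ => (k : ℝ)⁻¹)
          fun _ _ _ _ h => ZMod.val_injective p h]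
        refine Finset.sum_le_sum_of_subset_of_nonneg ?_ fun _ _ _ => by positivity
        intro k hk
        obtain ⟨t, ht, rfl⟩ := Finset.mem_image.mp hk
        have ht0 : t.val ≠ 0 := (ZMod.val_eq_zero t).not.mpr (Finset.mem_filter.mp ht).2
        exact Finset.mem_Icc.mpr ⟨Nat.pos_of_ne_zero ht0, (ZMod.val_lt t).le⟩
    _ ≤ _ := by
        have h := harmonic_le_one_add_log p
        rw [harmonic_eq_sum_Icc] at h
        push_cast at h
        exact h

theorem one_le_log_natCast {n : ℕ} (hn : 3 ≤ n) : 1 ≤ Real.log n := by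
  have hn' : (3 : ℝ) ≤ n := by exact_mod_cast hn
  rw [Real.le_log_iff_exp_le (by linarith)]
  linarith [Real.exp_one_lt_d9]

theorem sum_freqBound_le (hp3 : 3 ≤ p) :
    ∑ t : ZMod p with t ≠ 0, freqBound t ≤ 2 * p * Real.log p := by
  have hlog := one_le_log_natCast hp3
  have hval := sum_inv_val_le p
  have hneg : ∑ t : ZMod p with t ≠ 0, ((-t).val : ℝ)⁻¹ = ∑ t : ZMod p with t ≠ 0, (t.val : ℝ)⁻¹ :=
    Finset.sum_equiv (Equiv.neg _) (fun t => by simp) fun t _ => by rw [Equiv.neg_apply]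
  calc _ ≤ ∑ t : ZMod p with t ≠ 0, p / 2 * ((t.val : ℝ)⁻¹ + ((-t).val : ℝ)⁻¹) :=
        Finset.sum_le_sum fun t ht => freqBound_le_inv_val_add (Finset.mem_filter.mp ht).2
    _ = p / 2 * (∑ t : ZMod p with t ≠ 0, (t.val : ℝ)⁻¹
          + ∑ t : ZMod p with t ≠ 0, (t.val : ℝ)⁻¹) := by
        rw [← Finset.mul_sum, Finset.sum_add_distrib, hneg]
    _ ≤ p / 2 * ((1 + Real.log p) + (1 + Real.log p)) := by gcongr
    _ ≤ _ := by nlinarith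

theorem sum_freqBound_mul_le [Fact p.Prime] (hp3 : 3 ≤ p) {g : ZMod p} (hg : g ≠ 0) :
    ∑ h : ZMod p with h ≠ 0, freqBound (h * g) ≤ 2 * p * Real.log p :=
  (Finset.sum_equiv (Equiv.mulRight₀ g hg) (fun h => by simp [hg]) fun _ _ => rfl).trans_le
    (sum_freqBound_le hp3)

end IntervalSums

section FourierCount

theorem sum_prod_le_prod_sum {ι κ : Type*} {s : Finset ι} (hs : s.Nonempty) (t : Finset κ)
    {f : ι → κ → ℝ} (hf : ∀ i k, 0 ≤ f i k) :
    ∑ k ∈ t, ∏ i ∈ s, f i k ≤ ∏ i ∈ s, ∑ k ∈ t, f i k := by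
  classical
  obtain ⟨a, ha⟩ := hs
  calc _ = ∑ k ∈ t, f a k * ∏ i ∈ s.erase a, f i k :=
        Finset.sum_congr rfl fun k _ => (Finset.mul_prod_erase s _ ha).symm
    _ ≤ ∑ k ∈ t, f a k * ∏ i ∈ s.erase a, ∑ k ∈ t, f i k := by
        refine Finset.sum_le_sum fun k hk => mul_le_mul_of_nonneg_left ?_ (hf a k)
        exact Finset.prod_le_prod (fun i _ => hf i k) fun i _ =>
          Finset.single_le_sum (f := fun k => f i k) (fun k _ => hf i k) hk
    _ = _ := by rw [← Finset.sum_mul, Finset.mul_prod_erase s (fun i => ∑ k ∈ t, f i k) ha]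

theorem norm_sum_mul_sub_le {G : Type*} [Fintype G] [DecidableEq G] [Zero G] {b₁ b₂ : G → ℂ}
    {T : G → G → ℂ} {τ D₁ D₂ : ℝ} (hτ : 0 ≤ τ)
    (hT : ∀ h k, h ≠ 0 ∨ k ≠ 0 → ‖T h k‖ ≤ τ)
    (hD₁ : ∑ h with h ≠ 0, ‖b₁ h‖ ≤ D₁) (hD₂ : ∑ h with h ≠ 0, ‖b₂ h‖ ≤ D₂) :
    ‖∑ h, ∑ k, b₁ h * b₂ k * T h k - b₁ 0 * b₂ 0 * T 0 0‖
      ≤ τ * (‖b₁ 0‖ * D₂ + ‖b₂ 0‖ * D₁ + D₁ * D₂) := by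
  have hsplit (b : G → ℂ) : ∑ h, ‖b h‖ = ‖b 0‖ + ∑ h with h ≠ 0, ‖b h‖ := by
    rw [Finset.filter_ne',
      Finset.add_sum_erase Finset.univ (fun h => ‖b h‖) (Finset.mem_univ (0 : G))]
  have hprod : ∑ q ∈ Finset.univ.erase ((0, 0) : G × G), ‖b₁ q.1‖ * ‖b₂ q.2‖
      = (∑ h, ‖b₁ h‖) * (∑ k, ‖b₂ k‖) - ‖b₁ 0‖ * ‖b₂ 0‖ := by
    rw [Finset.sum_mul_sum, ← Fintype.sum_prod_type', ← Finset.add_sum_erase Finset.univ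
      (fun q : G × G => ‖b₁ q.1‖ * ‖b₂ q.2‖) (Finset.mem_univ (0, 0)), add_sub_cancel_left]
  have hD₁0 : 0 ≤ ∑ h with h ≠ 0, ‖b₁ h‖ := Finset.sum_nonneg fun _ _ => norm_nonneg _
  rw [← Fintype.sum_prod_type' fun h k => b₁ h * b₂ k * T h k,
    ← Finset.add_sum_erase Finset.univ _ (Finset.mem_univ ((0, 0) : G × G)), add_sub_cancel_left]
  calc _ ≤ ∑ q ∈ Finset.univ.erase ((0, 0) : G × G), ‖b₁ q.1 * b₂ q.2 * T q.1 q.2‖ :=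
        norm_sum_le _ _
    _ ≤ ∑ q ∈ Finset.univ.erase ((0, 0) : G × G), τ * (‖b₁ q.1‖ * ‖b₂ q.2‖) := by
        refine Finset.sum_le_sum fun q hq => ?_
        rw [norm_mul, norm_mul, mul_comm τ]
        gcongr
        apply hT
        by_contra! h
        exact Finset.ne_of_mem_erase hq (Prod.ext h.1 h.2)
    _ = τ * (‖b₁ 0‖ * (∑ h with h ≠ 0, ‖b₂ h‖) + ‖b₂ 0‖ * (∑ h with h ≠ 0, ‖b₁ h‖)
          + (∑ h with h ≠ 0, ‖b₁ h‖) * ∑ h with h ≠ 0, ‖b₂ h‖) := by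
        rw [← Finset.mul_sum, hprod, hsplit b₁, hsplit b₂]
        ring
    _ ≤ _ := by
        have hD := hD₁0.trans hD₁
        gcongr

variable {p : ℕ} [NeZero p]

theorem mul_card_filter_eq_sum {γ : Type*} (D : Finset γ) (f : γ → ZMod p) (c : ZMod p) :
    (p : ℂ) * ((D.filter fun x => f x = c).card : ℂ)
      = ∑ h : ZMod p, (∑ x ∈ D, ZMod.stdAddChar (h * f x)) * ZMod.stdAddChar (-(h * c)) := by
  simp only [Finset.sum_mul, ← AddChar.map_add_eq_mul]
  rw [Finset.sum_comm, Finset.card_filter, Nat.cast_sum, Finset.mul_sum]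
  refine Finset.sum_congr rfl fun x _ => ?_
  have hmul (h : ZMod p) : h * f x + -(h * c) = h * (f x - c) := by ring
  simp only [hmul, AddChar.sum_mulShift _ (ZMod.isPrimitive_stdAddChar p), sub_eq_zero, ZMod.card]
  split_ifs <;> simp

variable {U α β : Type*} (V : Finset U) (A : Finset α) (B : Finset β)
  (s t : U → ZMod p) (ξ : α → ZMod p) (η : β → ZMod p)

theorem sq_mul_sum_card_mul_card_eq_sum :
    (p : ℂ) ^ 2 * ∑ u ∈ V, (((A.filter fun x => ξ x = s u).card : ℂ)
        * ((B.filter fun y => η y = t u).card : ℂ))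
      = ∑ h : ZMod p, ∑ k : ZMod p, (∑ x ∈ A, ZMod.stdAddChar (h * ξ x))
        * (∑ y ∈ B, ZMod.stdAddChar (k * η y))
        * ∑ u ∈ V, ZMod.stdAddChar (-(h * s u + k * t u)) := by
  have hpoint (u : U) : (p : ℂ) ^ 2 * (((A.filter fun x => ξ x = s u).card : ℂ)
        * ((B.filter fun y => η y = t u).card : ℂ))
      = ∑ h : ZMod p, ∑ k : ZMod p, (∑ x ∈ A, ZMod.stdAddChar (h * ξ x))
        * (∑ y ∈ B, ZMod.stdAddChar (k * η y)) * ZMod.stdAddChar (-(h * s u + k * t u)) := by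
    rw [sq, mul_mul_mul_comm, mul_card_filter_eq_sum, mul_card_filter_eq_sum, Finset.sum_mul_sum]
    refine Finset.sum_congr rfl fun h _ => Finset.sum_congr rfl fun k _ => ?_
    rw [neg_add, AddChar.map_add_eq_mul]
    ring
  rw [Finset.mul_sum, Finset.sum_congr rfl fun u _ => hpoint u, Finset.sum_comm]
  refine Finset.sum_congr rfl fun h _ => ?_
  rw [Finset.sum_comm]
  exact Finset.sum_congr rfl fun k _ => (Finset.mul_sum _ _ _).symm

theorem abs_sq_mul_sum_card_mul_card_sub_le {τ D₁ D₂ : ℝ} (hτ : 0 ≤ τ)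
    (hT : ∀ h k : ZMod p, h ≠ 0 ∨ k ≠ 0 →
      ‖∑ u ∈ V, ZMod.stdAddChar (-(h * s u + k * t u))‖ ≤ τ)
    (hD₁ : ∑ h : ZMod p with h ≠ 0, ‖∑ x ∈ A, ZMod.stdAddChar (h * ξ x)‖ ≤ D₁)
    (hD₂ : ∑ h : ZMod p with h ≠ 0, ‖∑ x ∈ B, ZMod.stdAddChar (h * η x)‖ ≤ D₂) :
    |(p : ℝ) ^ 2 * ∑ u ∈ V, (((A.filter fun x => ξ x = s u).card : ℝ)
        * ((B.filter fun y => η y = t u).card : ℝ)) - A.card * B.card * V.card|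
      ≤ τ * (A.card * D₂ + B.card * D₁ + D₁ * D₂) := by
  have h := norm_sum_mul_sub_le hτ hT hD₁ hD₂
  rw [← sq_mul_sum_card_mul_card_eq_sum] at h
  simp only [zero_mul, add_zero, neg_zero, AddChar.map_zero_eq_one, Finset.sum_const,
    nsmul_eq_mul, mul_one, Complex.norm_natCast] at h
  rw [← Real.norm_eq_abs, ← Complex.norm_real]
  push_cast
  exact h

end FourierCount

section BoxSums

theorem addChar_map_sum {A M ι : Type*} [AddCommMonoid A] [CommMonoid M] (ψ : AddChar A M)
    (s : Finset ι) (f : ι → A) : ψ (∑ i ∈ s, f i) = ∏ i ∈ s, ψ (f i) :=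
  map_prod ψ.toMonoidHom (fun i => Multiplicative.ofAdd (f i)) s

/-- The integer vectors `x` with `a - b ≤ x ≤ a + b`, as a product of intervals so that sums over
it factor. -/
noncomputable def latticeBox {ι : Type*} [Fintype ι] [DecidableEq ι] (a b : ι → ℤ) :
    Finset (ι → ℤ) :=
  Fintype.piFinset fun j => Finset.Icc (a j - b j) (a j + b j)

variable {ι : Type*} [Fintype ι] [DecidableEq ι]

theorem card_latticeBox (a : ι → ℤ) {b : ι → ℤ} (hb : ∀ j, 0 ≤ b j) :
    ((latticeBox a b).card : ℝ) = ∏ j, (2 * (b j : ℝ) + 1) := by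
  rw [latticeBox, Fintype.card_piFinset, Nat.cast_prod]
  refine Finset.prod_congr rfl fun j _ => ?_
  have hnonneg : 0 ≤ a j + b j + 1 - (a j - b j) := by linarith [hb j]
  rw [Int.card_Icc, ← Int.cast_natCast, Int.toNat_of_nonneg hnonneg]
  push_cast
  ring

variable {p : ℕ} [Fact p.Prime] {g : ι → ZMod p}

theorem norm_sum_latticeBox_le (hg : ∀ j, g j ≠ 0) {h : ZMod p} (hh : h ≠ 0) (a b : ι → ℤ) :
    ‖∑ x ∈ latticeBox a b, ZMod.stdAddChar (h * ∑ j, (x j : ZMod p) * g j)‖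
      ≤ ∏ j, freqBound (h * g j) := by
  have hfactor (x : ι → ℤ) : ZMod.stdAddChar (h * ∑ j, (x j : ZMod p) * g j)
      = ∏ j, ZMod.stdAddChar (h * g j * (x j : ZMod p)) := by
    rw [Finset.mul_sum, addChar_map_sum]
    refine Finset.prod_congr rfl fun j _ => ?_
    congr 1
    ring
  simp only [hfactor]
  rw [latticeBox, ← Finset.prod_univ_sum (fun j => Finset.Icc (a j - b j) (a j + b j))
    (fun j x => ZMod.stdAddChar (h * g j * (x : ZMod p))), norm_prod]
  exact Finset.prod_le_prod (fun _ _ => norm_nonneg _) fun j _ =>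
    norm_sum_Icc_stdAddChar_le (mul_ne_zero hh (hg j)) _ _

omit [Fintype ι] [DecidableEq ι] in
theorem sum_prod_freqBound_le (hp3 : 3 ≤ p) (hg : ∀ j, g j ≠ 0) {s : Finset ι} (hs : s.Nonempty) :
    ∑ h : ZMod p with h ≠ 0, ∏ j ∈ s, freqBound (h * g j) ≤ (2 * p * Real.log p) ^ s.card :=
  calc _ ≤ ∏ j ∈ s, ∑ h : ZMod p with h ≠ 0, freqBound (h * g j) :=
        sum_prod_le_prod_sum hs _ fun _ _ => freqBound_nonneg _
    _ ≤ ∏ _j ∈ s, 2 * p * Real.log p :=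
        Finset.prod_le_prod (fun _ _ => Finset.sum_nonneg fun _ _ => freqBound_nonneg _)
          fun j _ => sum_freqBound_mul_le hp3 (hg j)
    _ = _ := Finset.prod_const _

theorem sum_norm_latticeBox_le [Nonempty ι] (hp3 : 3 ≤ p) (hg : ∀ j, g j ≠ 0) (a b : ι → ℤ) :
    ∑ h : ZMod p with h ≠ 0,
        ‖∑ x ∈ latticeBox a b, ZMod.stdAddChar (h * ∑ j, (x j : ZMod p) * g j)‖
      ≤ (2 * p * Real.log p) ^ Fintype.card ι :=
  (Finset.sum_le_sum fun _ hh =>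
      norm_sum_latticeBox_le hg (Finset.mem_filter.mp hh).2 a b).trans
    (sum_prod_freqBound_le hp3 hg Finset.univ_nonempty)

theorem prod_freqBound_le_sum {h : ZMod p} {M : ℝ} (hM : ∃ j, freqBound (h * g j) ≤ M) :
    ∏ j, freqBound (h * g j) ≤ ∑ i, M * ∏ j ∈ Finset.univ.erase i, freqBound (h * g j) := by
  obtain ⟨i, hi⟩ := hM
  have hnonneg (i : ι) : 0 ≤ ∏ j ∈ Finset.univ.erase i, freqBound (h * g j) :=
    Finset.prod_nonneg fun _ _ => freqBound_nonneg _
  have hM0 : 0 ≤ M := (freqBound_nonneg _).trans hi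
  rw [← Finset.mul_prod_erase Finset.univ _ (Finset.mem_univ i)]
  exact (mul_le_mul_of_nonneg_right hi (hnonneg i)).trans <| Finset.single_le_sum
    (f := fun i => M * ∏ j ∈ Finset.univ.erase i, freqBound (h * g j))
    (fun i _ => mul_nonneg hM0 (hnonneg i)) (Finset.mem_univ i)

theorem sum_norm_latticeBox_le_of_freqBound_le [Nontrivial ι] (hp3 : 3 ≤ p) (hg : ∀ j, g j ≠ 0)
    {M : ℝ} (hM : ∀ h : ZMod p, h ≠ 0 → ∃ j, freqBound (h * g j) ≤ M) (a b : ι → ℤ) :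
    ∑ h : ZMod p with h ≠ 0,
        ‖∑ x ∈ latticeBox a b, ZMod.stdAddChar (h * ∑ j, (x j : ZMod p) * g j)‖
      ≤ Fintype.card ι * (M * (2 * p * Real.log p) ^ (Fintype.card ι - 1)) := by
  have hM0 : 0 ≤ M := by
    obtain ⟨j, hj⟩ := hM 1 one_ne_zero
    exact (freqBound_nonneg _).trans hj
  calc _ ≤ ∑ h : ZMod p with h ≠ 0, ∑ i, M * ∏ j ∈ Finset.univ.erase i, freqBound (h * g j) :=
        Finset.sum_le_sum fun h hh =>
          (norm_sum_latticeBox_le hg (Finset.mem_filter.mp hh).2 a b).trans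
            (prod_freqBound_le_sum (hM h (Finset.mem_filter.mp hh).2))
    _ = ∑ i, M * ∑ h : ZMod p with h ≠ 0, ∏ j ∈ Finset.univ.erase i, freqBound (h * g j) := by
        rw [Finset.sum_comm]
        simp only [Finset.mul_sum]
    _ ≤ ∑ _i : ι, M * (2 * p * Real.log p) ^ (Fintype.card ι - 1) := by
        gcongr with i
        have hne : (Finset.univ.erase i).Nonempty :=
          (Finset.erase_nonempty (Finset.mem_univ i)).mpr Finset.univ_nontrivial
        refine (sum_prod_freqBound_le hp3 hg hne).trans_eq ?_
        rw [Finset.card_erase_of_mem (Finset.mem_univ i), Finset.card_univ]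
    _ = _ := by rw [Finset.sum_const, nsmul_eq_mul, Finset.card_univ]

end BoxSums

section ShortVectors

variable {R ι : Type*} [CommRing R]

theorem mul_eq_mul_swap_of_basis (γ : Module.Basis ι ℤ R) {φ : R →ₗ[ℤ] ℤ} {u v : R}
    (h : ∀ k l, φ (u * γ k) * φ (v * γ l) = φ (u * γ l) * φ (v * γ k)) (x y : R) :
    φ (u * x) * φ (v * y) = φ (u * y) * φ (v * x) := by
  let B := (LinearMap.mul ℤ ℤ).compl₁₂ (φ.comp (LinearMap.mulLeft ℤ u))
    (φ.comp (LinearMap.mulLeft ℤ v))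
  have hB : B = B.flip := γ.ext fun k => γ.ext fun l => h k l
  exact LinearMap.congr_fun₂ hB x y

/-- The sum of the absolute values of the structure constants of the multiplication of `R` in the
`ℤ`-basis `γ`. -/
noncomputable def structureConstantSum [Fintype ι] (γ : Module.Basis ι ℤ R) : ℝ :=
  ∑ i, ∑ j, ∑ l, |(γ.repr (γ i * γ j) l : ℝ)|

theorem structureConstantSum_nonneg [Fintype ι] (γ : Module.Basis ι ℤ R) :
    0 ≤ structureConstantSum γ := by
  unfold structureConstantSum
  positivity

theorem abs_constr_mul_le [Fintype ι] (γ : Module.Basis ι ℤ R) {r : ι → ℤ} {B : ℝ}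
    (hr : ∀ j, |(r j : ℝ)| ≤ B) (i j : ι) :
    |(γ.constr ℤ r (γ i * γ j) : ℝ)| ≤ structureConstantSum γ * B := by
  have hB : 0 ≤ B := (abs_nonneg _).trans (hr i)
  rw [Module.Basis.constr_apply_fintype, structureConstantSum, Int.cast_sum]
  calc _ ≤ ∑ l, |(γ.repr (γ i * γ j) l : ℝ)| * B := by
        refine (Finset.abs_sum_le_sum_abs _ _).trans (Finset.sum_le_sum fun l _ => ?_)
        rw [Module.Basis.equivFun_apply, smul_eq_mul, Int.cast_mul, abs_mul]
        exact mul_le_mul_of_nonneg_left (hr l) (abs_nonneg _)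
    _ = (∑ l, |(γ.repr (γ i * γ j) l : ℝ)|) * B := (Finset.sum_mul _ _ _).symm
    _ ≤ (∑ j, ∑ l, |(γ.repr (γ i * γ j) l : ℝ)|) * B := by
        refine mul_le_mul_of_nonneg_right ?_ hB
        exact Finset.single_le_sum (f := fun j => ∑ l, |(γ.repr (γ i * γ j) l : ℝ)|)
          (fun _ _ => by positivity) (Finset.mem_univ j)
    _ ≤ _ := by
        refine mul_le_mul_of_nonneg_right ?_ hB
        exact Finset.single_le_sum (f := fun i => ∑ j, ∑ l, |(γ.repr (γ i * γ j) l : ℝ)|)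
          (fun _ _ => by positivity) (Finset.mem_univ i)

theorem intCast_constr_eq_mul [Finite ι] (γ : Module.Basis ι ℤ R) {p : ℕ} {ρ : R →+* ZMod p}
    {h : ZMod p} {r : ι → ℤ} (hr : ∀ j, (r j : ZMod p) = h * ρ (γ j)) (x : R) :
    (γ.constr ℤ r x : ZMod p) = h * ρ x := by
  have := Fintype.ofFinite ι
  conv_rhs => rw [← γ.sum_repr x]
  rw [Module.Basis.constr_apply_fintype, Int.cast_sum, map_sum, Finset.mul_sum]
  refine Finset.sum_congr rfl fun j _ => ?_
  rw [Module.Basis.equivFun_apply, smul_eq_mul, Int.cast_mul, hr, zsmul_eq_mul, map_mul,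
    map_intCast]
  ring

variable [NoZeroDivisors R] [Algebra.IsAlgebraic ℤ R]

theorem linearMap_eq_zero_of_mul_eq_zero {φ : R →ₗ[ℤ] ℤ} {x : R} (hx : x ≠ 0)
    (h : ∀ y, φ (x * y) = 0) : φ = 0 := by
  ext z
  obtain ⟨c, d, hd, hz⟩ := Algebra.IsAlgebraic.exists_smul_eq_mul (R := ℤ) z hx
  have hφ : d * φ z = 0 := by rw [← smul_eq_mul, ← map_smul, hz, h]
  exact (mul_eq_zero.mp hφ).resolve_left hd

/-- If all minors vanished, `φ (γⱼ y) γᵢ - φ (γᵢ y) γⱼ` would be an element whose multiples are all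
killed by `φ`. -/
theorem exists_minor_ne_zero (γ : Module.Basis ι ℤ R) {φ : R →ₗ[ℤ] ℤ} (hφ : φ ≠ 0) {i j : ι}
    (hij : i ≠ j) :
    ∃ k l, φ (γ i * γ k) * φ (γ j * γ l) - φ (γ i * γ l) * φ (γ j * γ k) ≠ 0 := by
  by_contra! h
  have hswap := mul_eq_mul_swap_of_basis γ fun k l => sub_eq_zero.mp (h k l)
  obtain ⟨y, hy⟩ : ∃ y, φ (γ j * y) ≠ 0 := by
    by_contra! h'
    exact hφ (linearMap_eq_zero_of_mul_eq_zero (γ.ne_zero j) h')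
  have hz : φ (γ j * y) • γ i - φ (γ i * y) • γ j = 0 := by
    by_contra hne
    refine hφ (linearMap_eq_zero_of_mul_eq_zero hne fun x => ?_)
    rw [sub_mul, map_sub, smul_mul_assoc, smul_mul_assoc, map_smul, map_smul, smul_eq_mul,
      smul_eq_mul, ← hswap x y]
    ring
  refine hy ?_
  simpa only [map_sub, map_smul, Module.Basis.repr_self, Finsupp.sub_apply, Finsupp.smul_apply,
    Finsupp.single_eq_same, Finsupp.single_eq_of_ne hij, smul_zero, mul_zero, sub_zero, smul_eq_mul,
    mul_one, map_zero, Finsupp.zero_apply] using DFunLike.congr_fun (congrArg γ.repr hz) i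

theorem abs_mul_sub_mul_le {a b c d B : ℝ} (ha : |a| ≤ B) (hb : |b| ≤ B) (hc : |c| ≤ B)
    (hd : |d| ≤ B) : |a * b - c * d| ≤ 2 * B ^ 2 := by
  have hB : 0 ≤ B := (abs_nonneg a).trans ha
  calc |a * b - c * d| ≤ |a| * |b| + |c| * |d| := by
        rw [← abs_mul, ← abs_mul]
        exact abs_sub _ _
    _ ≤ B * B + B * B := by gcongr
    _ = 2 * B ^ 2 := by ring

/-- Modulo `p` the matrix `φ (γᵢ γⱼ) = h ρ(γᵢ) ρ(γⱼ)` has rank one, so that its minors are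
divisible by `p`. -/
theorem le_two_mul_sq_of_abs_le [Nontrivial ι] (γ : Module.Basis ι ℤ R) {p : ℕ}
    {ρ : R →+* ZMod p} {h : ZMod p} {φ : R →ₗ[ℤ] ℤ} (hφ0 : φ ≠ 0)
    (hφρ : ∀ x, ((φ x : ℤ) : ZMod p) = h * ρ x) {B : ℝ}
    (hB : ∀ i j, |(φ (γ i * γ j) : ℝ)| ≤ B) : (p : ℝ) ≤ 2 * B ^ 2 := by
  obtain ⟨i, j, hij⟩ := exists_pair_ne ι
  obtain ⟨k, l, hkl⟩ := exists_minor_ne_zero γ hφ0 hij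
  have hdvd : (p : ℤ) ∣ φ (γ i * γ k) * φ (γ j * γ l) - φ (γ i * γ l) * φ (γ j * γ k) := by
    rw [← ZMod.intCast_zmod_eq_zero_iff_dvd, Int.cast_sub, Int.cast_mul, Int.cast_mul]
    simp only [hφρ, map_mul]
    ring
  have hle : (p : ℝ) ≤ |(φ (γ i * γ k) : ℝ) * φ (γ j * γ l) - φ (γ i * γ l) * φ (γ j * γ k)| := by
    exact_mod_cast Int.le_of_dvd (abs_pos.mpr hkl) ((dvd_abs _ _).mpr hdvd)
  exact hle.trans (abs_mul_sub_mul_le (hB _ _) (hB _ _) (hB _ _) (hB _ _))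

/-- The coordinates of a nonzero multiple of `(ρ(γⱼ))ⱼ` cannot all be small residues: the linear
form with these coefficients is nonzero, and by `le_two_mul_sq_of_abs_le` its values on the products
`γᵢ γⱼ` cannot all be small. -/
theorem exists_freqBound_le [Nontrivial ι] [Fintype ι] (γ : Module.Basis ι ℤ R) {p : ℕ}
    [Fact p.Prime] {ρ : R →+* ZMod p} (hρ : ∀ j, ρ (γ j) ≠ 0) {h : ZMod p} (hh : h ≠ 0) :
    ∃ j, freqBound (h * ρ (γ j)) ≤ structureConstantSum γ * √p := by
  let r : ι → ℤ := fun j => (h * ρ (γ j)).valMinAbs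
  have hr (j : ι) : (r j : ZMod p) = h * ρ (γ j) := ZMod.coe_valMinAbs _
  have hr0 (j : ι) : 0 < |(r j : ℝ)| := abs_valMinAbs_pos (mul_ne_zero hh (hρ j))
  obtain ⟨m, -, hm⟩ := Finset.univ.exists_max_image (fun j => |(r j : ℝ)|) Finset.univ_nonempty
  have hφ : γ.constr ℤ r ≠ 0 := by
    intro h0
    have hrm : γ.constr ℤ r (γ m) = r m := γ.constr_basis ℤ r m
    rw [h0, LinearMap.zero_apply] at hrm
    exact (hr0 m).ne (by rw [← hrm, Int.cast_zero, abs_zero])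
  have hp := le_two_mul_sq_of_abs_le γ hφ (intCast_constr_eq_mul γ hr)
    (abs_constr_mul_le γ fun j => hm j (Finset.mem_univ j))
  have hS := structureConstantSum_nonneg γ
  have hsqrt : √p ≤ 2 * (structureConstantSum γ * |(r m : ℝ)|) := by
    rw [Real.sqrt_le_left (by positivity)]
    nlinarith only [sq_nonneg (structureConstantSum γ * |(r m : ℝ)|), hp]
  refine ⟨m, (div_le_iff₀ (mul_pos two_pos (hr0 m))).mpr ?_⟩
  calc (p : ℝ) = √p * √p := (Real.mul_self_sqrt (Nat.cast_nonneg p)).symm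
    _ ≤ √p * (2 * (structureConstantSum γ * |(r m : ℝ)|)) := by gcongr
    _ = structureConstantSum γ * √p * (2 * |(r m : ℝ)|) := by ring

end ShortVectors

section ShortModels

open CurveBox WeierstrassCurve

theorem shortModel_map {R S : Type*} [CommRing R] [CommRing S] (φ : R →+* S) (a b : R) :
    (shortModel a b).map φ = shortModel (φ a) (φ b) := by
  simp only [shortModel, WeierstrassCurve.map, map_zero]

variable {k : Type*} [Field k]

/-- The units `u` for which `(X, Y) ↦ (u² X, u³ Y)` carries `Y² = X³ + s X + t` to
`Y² = X³ + a X + b`. Outside characteristics `2` and `3` these are all the isomorphisms. -/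
def scalings (a b s t : k) : Set kˣ :=
  {u | s = (u : k) ^ 4 * a ∧ t = (u : k) ^ 6 * b}

theorem smul_shortModel_of_mem_scalings {u : kˣ} {a b s t : k} (hu : u ∈ scalings a b s t) :
    (⟨u, 0, 0, 0⟩ : VariableChange k) • shortModel s t = shortModel a b := by
  obtain ⟨rfl, rfl⟩ := hu
  ext <;> simp [variableChange_a₁, variableChange_a₂, variableChange_a₃, variableChange_a₄,
    variableChange_a₆, shortModel]

variable (h2 : (2 : k) ≠ 0) (h3 : (3 : k) ≠ 0)
include h2 h3

theorem eq_zero_and_mem_scalings_of_smul_shortModel_eq {C : VariableChange k} {a b s t : k}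
    (h : C • shortModel s t = shortModel a b) :
    (C.r = 0 ∧ C.s = 0 ∧ C.t = 0) ∧ C.u ∈ scalings a b s t := by
  have hu : (C.u : k) ≠ 0 := C.u.ne_zero
  have ha₁ := congrArg WeierstrassCurve.a₁ h
  have ha₂ := congrArg WeierstrassCurve.a₂ h
  have ha₃ := congrArg WeierstrassCurve.a₃ h
  have ha₄ := congrArg WeierstrassCurve.a₄ h
  have ha₆ := congrArg WeierstrassCurve.a₆ h
  simp only [variableChange_a₁, variableChange_a₂, variableChange_a₃, variableChange_a₄,
    variableChange_a₆, shortModel, Units.val_inv_eq_inv_val] at ha₁ ha₂ ha₃ ha₄ ha₆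
  have hs : C.s = 0 := by simpa [hu, h2] using ha₁
  have hr : C.r = 0 := by simpa [hu, h3, hs] using ha₂
  have ht : C.t = 0 := by simpa [hu, h2, hr] using ha₃
  refine ⟨⟨hr, hs, ht⟩, ?_, ?_⟩
  · rw [← ha₄]
    simp [hr, hs, ht, hu]
  · rw [← ha₆]
    simp [hr, ht, hu]

theorem isomorphic_shortModel_iff (a b s t : k) :
    Isomorphic (shortModel s t) (shortModel a b) ↔ (scalings a b s t).Nonempty :=
  ⟨fun ⟨C, hC⟩ => ⟨C.u, (eq_zero_and_mem_scalings_of_smul_shortModel_eq h2 h3 hC).2⟩,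
    fun ⟨_, hu⟩ => ⟨_, smul_shortModel_of_mem_scalings hu⟩⟩

theorem autCount_shortModel (a b : k) :
    autCount (shortModel a b) = (scalings a b a b).ncard :=
  Nat.card_congr
    { toFun C := ⟨C.1.u, (eq_zero_and_mem_scalings_of_smul_shortModel_eq h2 h3 C.2).2⟩
      invFun u := ⟨⟨u.1, 0, 0, 0⟩, smul_shortModel_of_mem_scalings u.2⟩
      left_inv := by
        rintro ⟨C, hC⟩
        obtain ⟨⟨hr, hs, ht⟩, -⟩ := eq_zero_and_mem_scalings_of_smul_shortModel_eq h2 h3 hC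
        exact Subtype.ext (VariableChange.ext rfl hr.symm hs.symm ht.symm)
      right_inv _ := rfl }

theorem autCount_shortModel_pos [Finite k] (a b : k) : 0 < autCount (shortModel a b) := by
  rw [autCount_shortModel h2 h3, Set.ncard_pos]
  exact ⟨1, by simp [scalings]⟩

omit h2 h3

theorem eq_pow_mul_self_iff {a : k} (ha : a ≠ 0) (u : kˣ) (n : ℕ) :
    a = (u : k) ^ n * a ↔ u ^ n = 1 := by
  rw [eq_comm, mul_eq_right₀ ha, ← Units.val_pow_eq_pow_val, Units.val_eq_one]

theorem ncard_units_pow_eq_one [Finite k] (d : ℕ) :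
    {u : kˣ | u ^ d = 1}.ncard = Nat.gcd d (Nat.card k - 1) := by
  rw [← Nat.card_units k, Nat.gcd_comm, ← IsCyclic.card_powMonoidHom_ker]
  rfl

include h2 in
theorem gcd_two_natCard_sub_one [Finite k] : Nat.gcd 2 (Nat.card k - 1) = 2 := by
  have := Fintype.ofFinite k
  have hchar : ringChar k ≠ 2 := fun h => h2 (by exact_mod_cast h ▸ ringChar.Nat.cast_ringChar)
  have hodd := FiniteField.odd_card_of_char_ne_two hchar
  rw [Nat.gcd_eq_left_iff_dvd, Nat.card_eq_fintype_card]
  omega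

include h2 h3

theorem autCount_eq_two [Finite k] {a b : k} (hab : a * b ≠ 0) :
    autCount (shortModel a b) = 2 := by
  rw [autCount_shortModel h2 h3, ← gcd_two_natCard_sub_one h2, ← ncard_units_pow_eq_one]
  congr 1
  ext u
  simp only [scalings, Set.mem_ofPred_eq, eq_pow_mul_self_iff (left_ne_zero_of_mul hab),
    eq_pow_mul_self_iff (right_ne_zero_of_mul hab)]
  constructor
  · rintro ⟨h4, h6⟩
    rwa [show 6 = 4 + 2 from rfl, pow_add, h4, one_mul] at h6
  · intro h
    exact ⟨by rw [show 4 = 2 * 2 from rfl, pow_mul, h, one_pow],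
      by rw [show 6 = 2 * 3 from rfl, pow_mul, h, one_pow]⟩

theorem autCount_eq_gcd_four [Finite k] {a : k} (ha : a ≠ 0) :
    autCount (shortModel a 0) = Nat.gcd 4 (Nat.card k - 1) := by
  rw [autCount_shortModel h2 h3, ← ncard_units_pow_eq_one]
  simp only [scalings, eq_pow_mul_self_iff ha, mul_zero, and_true]

theorem autCount_eq_gcd_six [Finite k] {b : k} (hb : b ≠ 0) :
    autCount (shortModel 0 b) = Nat.gcd 6 (Nat.card k - 1) := by
  rw [autCount_shortModel h2 h3, ← ncard_units_pow_eq_one]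
  simp only [scalings, eq_pow_mul_self_iff hb, mul_zero, true_and]

omit h2 h3

theorem ncard_scalings_eq {a b s t : k} (h : (scalings a b s t).Nonempty) :
    (scalings a b s t).ncard = (scalings a b a b).ncard := by
  obtain ⟨v, rfl, rfl⟩ := h
  have hmem (u : kˣ) : v * u ∈ scalings a b (v ^ 4 * a) (v ^ 6 * b) ↔ u ∈ scalings a b a b := by
    simp only [scalings, Set.mem_ofPred_eq, Units.val_mul, mul_pow, mul_assoc,
      mul_right_inj' (pow_ne_zero _ v.ne_zero)]
  exact (Nat.card_congr ((Equiv.mulLeft v).subtypeEquiv fun u => (hmem u).symm)).symm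

/-- A field isomorphism transports scalings. -/
def scalingsEquiv {F : Type*} [Field F] (e : k ≃+* F) (a b s t : k) :
    scalings a b s t ≃ scalings (e a) (e b) (e s) (e t) :=
  (Units.mapEquiv e.toMulEquiv).toEquiv.subtypeEquiv fun u => by
    simp [scalings, ← map_pow, ← map_mul]

end ShortModels

section ModelCount

open CurveBox

theorem mul_card_filter_eq_sum_ncard {ι U : Type*} (s : Finset ι) (S : ι → Set U)
    [DecidablePred fun q => (S q).Nonempty] {N : ℕ}
    (hS : ∀ q, (S q).Nonempty → (S q).ncard = N) :
    N * (s.filter fun q => (S q).Nonempty).card = ∑ q ∈ s, (S q).ncard := by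
  rw [mul_comm, ← smul_eq_mul, ← Finset.sum_const, Finset.sum_filter]
  refine Finset.sum_congr rfl fun q _ => ?_
  split_ifs with h
  · rw [hS q h]
  · rw [Set.not_nonempty_iff_eq_empty.mp h, Set.ncard_empty]

/-- The number of triples `(u, x, y)` of a unit and points of the two boxes such that the linear
form with coefficients `g` takes the values `u⁴ a` and `u⁶ b` at `x` and `y`. -/
noncomputable def orbitBoxCount {ι F : Type*} [Fintype ι] [DecidableEq ι] [Field F]
    [DecidableEq F] [Fintype Fˣ] (g : ι → F) (a b : F) (a₁ b₁ a₂ b₂ : ι → ℤ) : ℕ :=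
  ∑ u : Fˣ, ((latticeBox a₁ b₁).filter fun x => ∑ j, (x j : F) * g j = (u : F) ^ 4 * a).card
    * ((latticeBox a₂ b₂).filter fun y => ∑ j, (y j : F) * g j = (u : F) ^ 6 * b).card

theorem sum_ncard_scalings_eq_orbitBoxCount {ι F : Type*} [Fintype ι] [DecidableEq ι] [Field F]
    [DecidableEq F] [Fintype Fˣ] (g : ι → F) (a b : F) (a₁ b₁ a₂ b₂ : ι → ℤ) :
    ∑ q ∈ latticeBox a₁ b₁ ×ˢ latticeBox a₂ b₂,
        (scalings a b (∑ j, (q.1 j : F) * g j) (∑ j, (q.2 j : F) * g j)).ncard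
      = orbitBoxCount g a b a₁ b₁ a₂ b₂ := by
  have hcard (s t : F) : (scalings a b s t).ncard
      = ∑ u : Fˣ, if s = (u : F) ^ 4 * a ∧ t = (u : F) ^ 6 * b then 1 else 0 := by
    rw [← Finset.card_filter, ← Set.ncard_coe_finset, Finset.coe_filter_univ]
    rfl
  simp only [hcard]
  rw [Finset.sum_comm]
  refine Finset.sum_congr rfl fun u _ => ?_
  rw [← Finset.card_product, ← Finset.filter_product, Finset.card_filter]

variable {K : Type*} [Field K] [NumberField K]
  (γ : Module.Basis (Fin (Module.finrank ℚ K)) ℤ (𝓞 K))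

theorem equivFun_symm_mem_intBox_iff (a b x : Fin (Module.finrank ℚ K) → ℤ) :
    γ.equivFun.symm x ∈ intBox γ a b ↔ x ∈ latticeBox a b := by
  simp only [intBox, Set.mem_ofPred_eq, ← γ.equivFun_apply, LinearEquiv.apply_symm_apply,
    latticeBox, Fintype.mem_piFinset, Finset.mem_Icc]

theorem map_equivFun_symm {R : Type*} [CommRing R] (ρ : 𝓞 K →+* R)
    (x : Fin (Module.finrank ℚ K) → ℤ) : ρ (γ.equivFun.symm x) = ∑ j, (x j : R) * ρ (γ j) := by
  simp only [Module.Basis.equivFun_symm_apply, map_sum, zsmul_eq_mul, map_mul, map_intCast]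

/-- The model whose coefficients have the given coordinate vectors with respect to `γ`. -/
noncomputable def modelOfCoords
    (q : (Fin (Module.finrank ℚ K) → ℤ) × (Fin (Module.finrank ℚ K) → ℤ)) :
    WeierstrassCurve (𝓞 K) :=
  shortModel (γ.equivFun.symm q.1) (γ.equivFun.symm q.2)

theorem modelOfCoords_injective : Function.Injective (modelOfCoords γ) := fun _ _ h =>
  Prod.ext (γ.equivFun.symm.injective (congrArg WeierstrassCurve.a₄ h))
    (γ.equivFun.symm.injective (congrArg WeierstrassCurve.a₆ h))

variable {γ} {P : Ideal (𝓞 K)} [P.IsMaximal] (h2 : (2 : 𝓞 K ⧸ P) ≠ 0) (h3 : (3 : 𝓞 K ⧸ P) ≠ 0)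
  {F : Type*} [Field F] (e : 𝓞 K ⧸ P ≃+* F) (a b : 𝓞 K ⧸ P)
include h2 h3

variable (γ) in
theorem isomorphic_modelOfCoords_map_iff
    (q : (Fin (Module.finrank ℚ K) → ℤ) × (Fin (Module.finrank ℚ K) → ℤ)) :
    Isomorphic ((modelOfCoords γ q).map (Ideal.Quotient.mk P)) (shortModel a b) ↔
      (scalings (e a) (e b) (∑ j, (q.1 j : F) * e (Ideal.Quotient.mk P (γ j)))
        (∑ j, (q.2 j : F) * e (Ideal.Quotient.mk P (γ j)))).Nonempty := by
  let := Ideal.Quotient.field P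
  have hred := map_equivFun_symm γ ((e : 𝓞 K ⧸ P →+* F).comp (Ideal.Quotient.mk P))
  simp only [RingHom.comp_apply, RingHom.coe_coe] at hred
  rw [modelOfCoords, shortModel_map, isomorphic_shortModel_iff h2 h3, ← hred, ← hred,
    ← Set.nonempty_coe_sort, ← Set.nonempty_coe_sort]
  exact (scalingsEquiv e _ _ _ _).nonempty_congr

variable (a₁ b₁ a₂ b₂ : Fin (Module.finrank ℚ K) → ℤ)

open scoped Classical in
theorem ncard_modelsReducingTo_eq :
    (modelsReducingTo γ a₁ b₁ a₂ b₂ P (shortModel a b)).ncard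
      = ((latticeBox a₁ b₁ ×ˢ latticeBox a₂ b₂).filter fun q =>
        (scalings (e a) (e b) (∑ j, (q.1 j : F) * e (Ideal.Quotient.mk P (γ j)))
          (∑ j, (q.2 j : F) * e (Ideal.Quotient.mk P (γ j)))).Nonempty).card := by
  rw [← Set.ncard_coe_finset, ← Set.ncard_image_of_injective _ (modelOfCoords_injective γ)]
  congr 1
  ext W
  simp only [← isomorphic_modelOfCoords_map_iff γ h2 h3 e, modelsReducingTo, modelBox,
    Set.mem_ofPred_eq, Set.mem_image, Finset.mem_coe, Finset.mem_filter, Finset.mem_product,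
    ← equivFun_symm_mem_intBox_iff γ]
  constructor
  · rintro ⟨⟨α, hα, β, hβ, rfl⟩, h⟩
    refine ⟨(γ.equivFun α, γ.equivFun β), ?_, ?_⟩ <;>
      simp only [modelOfCoords, LinearEquiv.symm_apply_apply]
    exact ⟨⟨hα, hβ⟩, h⟩
  · rintro ⟨q, ⟨⟨hα, hβ⟩, h⟩, rfl⟩
    exact ⟨⟨_, hα, _, hβ, rfl⟩, h⟩

theorem autCount_mul_ncard_eq [DecidableEq F] [Fintype Fˣ] :
    autCount (shortModel a b) * (modelsReducingTo γ a₁ b₁ a₂ b₂ P (shortModel a b)).ncard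
      = orbitBoxCount (fun j => e (Ideal.Quotient.mk P (γ j))) (e a) (e b) a₁ b₁ a₂ b₂ := by
  classical
  let := Ideal.Quotient.field P
  rw [autCount_shortModel h2 h3, ← Nat.card_coe_set_eq,
    Nat.card_congr (scalingsEquiv e a b a b), Nat.card_coe_set_eq,
    ncard_modelsReducingTo_eq h2 h3 e,
    mul_card_filter_eq_sum_ncard _ _ fun _ => ncard_scalings_eq,
    sum_ncard_scalings_eq_orbitBoxCount]

end ModelCount

section UnitSums

open Polynomial

theorem sum_units_eq {F M : Type*} [Field F] [Fintype F] [Fintype Fˣ] [AddCommGroup M]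
    (f : F → M) : ∑ u : Fˣ, f u = ∑ x, f x - f 0 := by
  classical
  rw [← Finset.add_sum_erase Finset.univ f (Finset.mem_univ 0), add_sub_cancel_left]
  refine Finset.sum_bij (fun u _ => (u : F)) ?_ ?_ ?_ ?_
  · exact fun u _ => Finset.mem_erase.mpr ⟨u.ne_zero, Finset.mem_univ _⟩
  · exact fun u _ v _ h => Units.ext h
  · exact fun x hx => ⟨Units.mk0 x (Finset.ne_of_mem_erase hx), Finset.mem_univ _, rfl⟩
  · exact fun _ _ => rfl

variable {p : ℕ} [Fact p.Prime]

theorem norm_sum_units_addChar_eval_le {ψ : AddChar (ZMod p) ℂ} (hψ : ψ ≠ 1) {f : (ZMod p)[X]}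
    (h0 : f.coeff 0 = 0) (hd : 0 < f.natDegree) (hcop : p.Coprime f.natDegree) :
    ‖∑ u : (ZMod p)ˣ, ψ (f.eval (u : ZMod p))‖ ≤ f.natDegree * √p := by
  have hsqrt : 1 ≤ √(p : ℝ) := Real.one_le_sqrt.mpr (by exact_mod_cast (Fact.out : p.Prime).one_le)
  have hweil := norm_sum_addChar_eval_le hψ h0 hd hcop
  rw [Nat.cast_pred hd] at hweil
  rw [sum_units_eq fun x => ψ (f.eval x)]
  calc _ ≤ ‖∑ x, ψ (f.eval x)‖ + ‖ψ (f.eval 0)‖ := norm_sub_le _ _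
    _ ≤ (f.natDegree - 1) * √p + √p := by
        rw [AddChar.norm_apply]
        exact add_le_add hweil hsqrt
    _ = f.natDegree * √p := by ring

theorem natDegree_C_mul_X_pow_add_C_mul_X_pow {R : Type*} [Semiring R] {m n : ℕ} (hmn : m < n)
    {c d : R} (hcd : c ≠ 0 ∨ d ≠ 0) :
    (C c * X ^ m + C d * X ^ n).natDegree = m ∨ (C c * X ^ m + C d * X ^ n).natDegree = n := by
  by_cases hd : d = 0
  · left
    rw [hd, C_0, zero_mul, add_zero, natDegree_C_mul_X_pow m c (hcd.resolve_right (not_not.mpr hd))]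
  · right
    rw [natDegree_add_eq_right_of_natDegree_lt, natDegree_C_mul_X_pow n d hd]
    rw [natDegree_C_mul_X_pow n d hd]
    exact (natDegree_C_mul_X_pow_le c m).trans_lt hmn

theorem norm_sum_units_stdAddChar_le (hp5 : 5 ≤ p) {c d : ZMod p} (hcd : c ≠ 0 ∨ d ≠ 0) :
    ‖∑ u : (ZMod p)ˣ, ZMod.stdAddChar (c * (u : ZMod p) ^ 4 + d * (u : ZMod p) ^ 6)‖
      ≤ 6 * √p := by
  have hp := (Fact.out : p.Prime)
  have hψ : (ZMod.stdAddChar : AddChar (ZMod p) ℂ) ≠ 1 := by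
    simpa only [AddChar.mulShift_one] using ZMod.isPrimitive_stdAddChar p one_ne_zero
  set f : (ZMod p)[X] := C c * X ^ 4 + C d * X ^ 6 with hf
  have hdeg : f.natDegree = 4 ∨ f.natDegree = 6 :=
    natDegree_C_mul_X_pow_add_C_mul_X_pow (by norm_num) hcd
  have hcop2 : p.Coprime 2 := (Nat.coprime_primes hp Nat.prime_two).mpr (by lia)
  have hcop3 : p.Coprime 3 := (Nat.coprime_primes hp Nat.prime_three).mpr (by lia)
  have hcop : p.Coprime f.natDegree := by
    rcases hdeg with h | h <;> rw [h]
    · exact hcop2.mul_right hcop2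
    · exact hcop2.mul_right hcop3
  have hsum := norm_sum_units_addChar_eval_le hψ (by simp [hf]) (by lia) hcop
  simp only [hf, eval_add, eval_mul, eval_C, eval_pow, eval_X] at hsum
  rw [← hf] at hsum
  have hdeg6 : (f.natDegree : ℝ) ≤ 6 := by exact_mod_cast (by lia : f.natDegree ≤ 6)
  exact hsum.trans (by gcongr)

theorem norm_sum_units_addChar_le {ψ : AddChar (ZMod p) ℂ} (f : (ZMod p)ˣ → ZMod p) :
    ‖∑ u, ψ (f u)‖ ≤ p := by
  refine (norm_sum_le _ _).trans ?_
  simp only [AddChar.norm_apply, Finset.sum_const, Finset.card_univ, nsmul_eq_mul, mul_one]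
  rw [ZMod.card_units_eq_totient]
  exact_mod_cast Nat.totient_le p

end UnitSums

section OrbitCount

variable {ι : Type*} [Fintype ι] [DecidableEq ι] {p : ℕ} [Fact p.Prime] {g : ι → ZMod p}
  {a b : ZMod p}

theorem abs_orbitBoxCount_sub_le {τ D : ℝ}
    (hT : ∀ h k : ZMod p, h ≠ 0 ∨ k ≠ 0 → ‖∑ u : (ZMod p)ˣ,
      ZMod.stdAddChar (-(h * ((u : ZMod p) ^ 4 * a) + k * ((u : ZMod p) ^ 6 * b)))‖ ≤ τ)
    (hD : ∀ c d : ι → ℤ, ∑ h : ZMod p with h ≠ 0,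
        ‖∑ x ∈ latticeBox c d, ZMod.stdAddChar (h * ∑ j, (x j : ZMod p) * g j)‖ ≤ D)
    (a₁ b₁ a₂ b₂ : ι → ℤ) :
    |(p : ℝ) ^ 2 * orbitBoxCount g a b a₁ b₁ a₂ b₂
        - (latticeBox a₁ b₁).card * (latticeBox a₂ b₂).card * (p - 1)|
      ≤ τ * (((latticeBox a₁ b₁).card + (latticeBox a₂ b₂).card) * D + D ^ 2) := by
  have hp := (Fact.out : p.Prime)
  have hτ : 0 ≤ τ := (norm_nonneg _).trans (hT 1 0 (Or.inl one_ne_zero))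
  have h := abs_sq_mul_sum_card_mul_card_sub_le (Finset.univ : Finset (ZMod p)ˣ)
    (latticeBox a₁ b₁) (latticeBox a₂ b₂) _ _ _ _ hτ hT (hD a₁ b₁) (hD a₂ b₂)
  rw [Finset.card_univ, ZMod.card_units_eq_totient, Nat.totient_prime hp, Nat.cast_pred hp.pos] at h
  rw [orbitBoxCount]
  push_cast
  refine h.trans_eq ?_
  ring

theorem abs_orbitBoxCount_sub_le_of_mul_ne_zero [Nonempty ι] (hp5 : 5 ≤ p) (hg : ∀ j, g j ≠ 0)
    (hab : a * b ≠ 0) (a₁ b₁ a₂ b₂ : ι → ℤ) :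
    |(p : ℝ) ^ 2 * orbitBoxCount g a b a₁ b₁ a₂ b₂
        - (latticeBox a₁ b₁).card * (latticeBox a₂ b₂).card * (p - 1)|
      ≤ 6 * 4 ^ Fintype.card ι * (((latticeBox a₁ b₁).card + (latticeBox a₂ b₂).card)
          * (p ^ Fintype.card ι * √p * Real.log p ^ Fintype.card ι)
        + p ^ (2 * Fintype.card ι) * √p * Real.log p ^ (2 * Fintype.card ι)) := by
  have hT (h k : ZMod p) (hhk : h ≠ 0 ∨ k ≠ 0) : ‖∑ u : (ZMod p)ˣ,
      ZMod.stdAddChar (-(h * ((u : ZMod p) ^ 4 * a) + k * ((u : ZMod p) ^ 6 * b)))‖ ≤ 6 * √p := by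
    have hcoeff : -(h * a) ≠ 0 ∨ -(k * b) ≠ 0 := by
      simpa [left_ne_zero_of_mul hab, right_ne_zero_of_mul hab] using hhk
    convert norm_sum_units_stdAddChar_le hp5 hcoeff using 5
    ring
  have hD := sum_norm_latticeBox_le (show 3 ≤ p by lia) hg
  have hlog := one_le_log_natCast (show 3 ≤ p by lia)
  refine (abs_orbitBoxCount_sub_le hT hD a₁ b₁ a₂ b₂).trans ?_
  set X : ℝ := (latticeBox a₁ b₁).card + (latticeBox a₂ b₂).card with hX
  set n := Fintype.card ι
  calc _ = 6 * (2 ^ n * (X * (p ^ n * √p * Real.log p ^ n))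
          + 4 ^ n * (p ^ (2 * n) * √p * Real.log p ^ (2 * n))) := by
        rw [show (4 : ℝ) ^ n = 2 ^ (2 * n) by rw [pow_mul]; norm_num]
        ring
    _ ≤ 6 * (4 ^ n * (X * (p ^ n * √p * Real.log p ^ n))
          + 4 ^ n * (p ^ (2 * n) * √p * Real.log p ^ (2 * n))) := by
        gcongr
        norm_num
    _ = _ := by ring

/-- When `a b = 0` the sums over the orbit need not cancel; the saving of `√p` over the trivial
bound comes instead from `hS`. -/
theorem abs_orbitBoxCount_sub_le_of_freqBound_le [Nontrivial ι] (hp3 : 3 ≤ p) (hg : ∀ j, g j ≠ 0)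
    {S : ℝ} (hS : ∀ h : ZMod p, h ≠ 0 → ∃ j, freqBound (h * g j) ≤ S * √p) (a₁ b₁ a₂ b₂ : ι → ℤ) :
    |(p : ℝ) ^ 2 * orbitBoxCount g a b a₁ b₁ a₂ b₂
        - (latticeBox a₁ b₁).card * (latticeBox a₂ b₂).card * (p - 1)|
      ≤ (S * Fintype.card ι * 2 ^ (Fintype.card ι - 1)
          + (S * Fintype.card ι * 2 ^ (Fintype.card ι - 1)) ^ 2)
        * (((latticeBox a₁ b₁).card + (latticeBox a₂ b₂).card)
          * (p ^ Fintype.card ι * √p * Real.log p ^ Fintype.card ι)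
        + p ^ (2 * Fintype.card ι) * √p * Real.log p ^ (2 * Fintype.card ι)) := by
  have hp : (0 : ℝ) < p := Nat.cast_pos.mpr (Fact.out : p.Prime).pos
  have hlog := one_le_log_natCast hp3
  have hD := sum_norm_latticeBox_le_of_freqBound_le hp3 hg hS
  refine (abs_orbitBoxCount_sub_le (fun _ _ _ => norm_sum_units_addChar_le _) hD
    a₁ b₁ a₂ b₂).trans ?_
  have hS0 : 0 ≤ S := by
    obtain ⟨j, hj⟩ := hS 1 one_ne_zero
    exact nonneg_of_mul_nonneg_left ((freqBound_nonneg _).trans hj) (Real.sqrt_pos.mpr hp)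
  set X : ℝ := (latticeBox a₁ b₁).card + (latticeBox a₂ b₂).card with hX
  obtain ⟨m, hm⟩ : ∃ m, Fintype.card ι = m + 1 := ⟨_, (Nat.succ_pred Fintype.card_ne_zero).symm⟩
  rw [hm, Nat.add_sub_cancel]
  set κ : ℝ := S * (m + 1 : ℕ) * 2 ^ m with hκ
  calc _ = κ * (X * (p ^ (m + 1) * √p * Real.log p ^ m))
          + κ ^ 2 * (p ^ (2 * m + 1) * (√p * √p) * Real.log p ^ (2 * m)) := by ring
    _ = κ * (X * (p ^ (m + 1) * √p * Real.log p ^ m))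
          + κ ^ 2 * (p ^ (2 * (m + 1)) * 1 * Real.log p ^ (2 * m)) := by
        rw [Real.mul_self_sqrt hp.le]
        ring
    _ ≤ (κ + κ ^ 2) * (X * (p ^ (m + 1) * √p * Real.log p ^ (m + 1)))
          + (κ + κ ^ 2) * (p ^ (2 * (m + 1)) * √p * Real.log p ^ (2 * (m + 1))) := by
        gcongr
        · exact le_add_of_nonneg_right (sq_nonneg κ)
        · exact Nat.le_succ m
        · exact le_add_of_nonneg_left (by positivity)
        · exact Real.one_le_sqrt.mpr (by exact_mod_cast (Fact.out : p.Prime).one_le)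
        · exact Nat.le_succ m
    _ = _ := by ring

theorem exists_abs_orbitBoxCount_sub_le [Nonempty ι] {R : Type*} [CommRing R] [NoZeroDivisors R]
    [Algebra.IsAlgebraic ℤ R] (γ : Module.Basis ι ℤ R) :
    ∃ κ : ℝ, 0 ≤ κ ∧ ∀ (p : ℕ) [Fact p.Prime] (ρ : R →+* ZMod p), 5 ≤ p →
      (∀ j, ρ (γ j) ≠ 0) → ∀ a b : ZMod p, (Fintype.card ι = 1 → a * b ≠ 0) →
      ∀ a₁ b₁ a₂ b₂ : ι → ℤ,
      |(p : ℝ) ^ 2 * orbitBoxCount (fun j => ρ (γ j)) a b a₁ b₁ a₂ b₂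
          - (latticeBox a₁ b₁).card * (latticeBox a₂ b₂).card * (p - 1)|
        ≤ κ * (((latticeBox a₁ b₁).card + (latticeBox a₂ b₂).card)
            * (p ^ Fintype.card ι * √p * Real.log p ^ Fintype.card ι)
          + p ^ (2 * Fintype.card ι) * √p * Real.log p ^ (2 * Fintype.card ι)) := by
  rcases subsingleton_or_nontrivial ι with _ | _
  · exact ⟨_, by positivity, fun p _ ρ hp5 hρ a b hab =>
      abs_orbitBoxCount_sub_le_of_mul_ne_zero hp5 hρ
        (hab (Fintype.card_le_one_iff_subsingleton.mpr ‹_› |>.antisymm Fintype.card_pos))⟩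
  · have hS := structureConstantSum_nonneg γ
    exact ⟨_, by positivity, fun p _ ρ hp5 hρ a b _ =>
      abs_orbitBoxCount_sub_le_of_freqBound_le (by lia) hρ fun h hh => exists_freqBound_le γ hρ hh⟩

end OrbitCount

section Volumes

theorem prod_add_one_sub_prod_le {ι : Type*} (s : Finset ι) {y : ι → ℝ} {m : ℝ} (hm : 1 ≤ m)
    (hy : ∀ i ∈ s, m ≤ y i) :
    ∏ i ∈ s, (y i + 1) - ∏ i ∈ s, y i ≤ (2 ^ s.card - 1) * ((∏ i ∈ s, y i) / m) := by
  classical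
  induction s using Finset.induction_on with
  | empty => simp
  | insert i s his ih =>
    have hs := ih fun j hj => hy j (Finset.mem_insert_of_mem hj)
    have hmi := hy i (Finset.mem_insert_self i s)
    have hQ : 0 ≤ ∏ j ∈ s, y j := Finset.prod_nonneg fun j hj =>
      (zero_le_one.trans hm).trans (hy j (Finset.mem_insert_of_mem hj))
    have hc : 1 ≤ (2 : ℝ) ^ s.card := one_le_pow₀ one_le_two
    rw [Finset.prod_insert his, Finset.prod_insert his, Finset.card_insert_of_notMem his, pow_succ]
    set R := ∏ j ∈ s, (y j + 1)
    set Q := ∏ j ∈ s, y j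
    set c : ℝ := 2 ^ s.card
    have hyi : 0 ≤ y i + 1 := by linarith
    calc (y i + 1) * R - y i * Q = (y i + 1) * (R - Q) + m * (Q / m) := by
          field_simp
          ring
      _ ≤ (y i + 1) * ((c - 1) * (Q / m)) + m * (Q / m) := by gcongr
      _ ≤ (y i + y i) * ((c - 1) * (Q / m)) + y i * (Q / m) := by
          gcongr
          exact hm.trans hmi
      _ = (c * 2 - 1) * (y i * Q / m) := by ring

theorem prod_add_one_le {ι : Type*} (s : Finset ι) {y : ι → ℝ} (hy : ∀ i ∈ s, 1 ≤ y i) :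
    ∏ i ∈ s, (y i + 1) ≤ 2 ^ s.card * ∏ i ∈ s, y i := by
  rw [← Finset.prod_const, ← Finset.prod_mul_distrib]
  exact Finset.prod_le_prod (fun i hi => by linarith [hy i hi]) fun i hi => by linarith [hy i hi]

open CurveBox

variable {n : ℕ}

theorem vol_eq_prod (b : Fin n → ℤ) : vol b = ∏ j, (2 * (b j : ℝ)) := by
  rw [vol, Finset.prod_mul_distrib, Finset.prod_const, Finset.card_univ, Fintype.card_fin]

theorem volTotal_eq_mul (b₁ b₂ : Fin n → ℤ) : volTotal b₁ b₂ = vol b₁ * vol b₂ := by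
  rw [volTotal, vol, vol, Finset.prod_mul_distrib]
  ring

theorem vol_nonneg {b : Fin n → ℤ} (hb : ∀ j, 0 ≤ b j) : 0 ≤ vol b := by
  rw [vol_eq_prod]
  exact Finset.prod_nonneg fun j _ => mul_nonneg zero_le_two (Int.cast_nonneg (hb j))

theorem vol_le_card_latticeBox (a : Fin n → ℤ) {b : Fin n → ℤ} (hb : ∀ j, 0 ≤ b j) :
    vol b ≤ (latticeBox a b).card := by
  rw [card_latticeBox a hb, vol_eq_prod]
  exact Finset.prod_le_prod (fun j _ => mul_nonneg zero_le_two (Int.cast_nonneg (hb j)))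
    fun j _ => le_add_of_nonneg_right zero_le_one

theorem card_latticeBox_le (a : Fin n → ℤ) {b : Fin n → ℤ} (hb : ∀ j, 0 < b j) :
    ((latticeBox a b).card : ℝ) ≤ 2 ^ n * vol b := by
  have hone (j : Fin n) : 1 ≤ 2 * (b j : ℝ) := by exact_mod_cast (by linarith [hb j] : 1 ≤ 2 * b j)
  rw [card_latticeBox a fun j => (hb j).le, vol_eq_prod]
  simpa only [Finset.card_univ, Fintype.card_fin] using
    prod_add_one_le Finset.univ fun j _ => hone j

variable {b₁ b₂ : Fin n → ℤ}

theorem volMin_le (j : Fin n) : volMin b₁ b₂ ≤ 2 * b₁ j ∧ volMin b₁ b₂ ≤ 2 * b₂ j := by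
  have hmin : ⨅ j, min (b₁ j : ℝ) (b₂ j : ℝ) ≤ min (b₁ j : ℝ) (b₂ j : ℝ) :=
    ciInf_le (Set.finite_range _).bddBelow j
  obtain ⟨h₁, h₂⟩ := le_min_iff.mp hmin
  exact ⟨mul_le_mul_of_nonneg_left h₁ zero_le_two, mul_le_mul_of_nonneg_left h₂ zero_le_two⟩

variable [NeZero n]

theorem one_le_volMin (hb₁ : ∀ j, 0 < b₁ j) (hb₂ : ∀ j, 0 < b₂ j) : 1 ≤ volMin b₁ b₂ := by
  have hmin : (1 : ℝ) ≤ ⨅ j, min (b₁ j : ℝ) (b₂ j : ℝ) := le_ciInf fun j =>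
    le_min (by exact_mod_cast hb₁ j) (by exact_mod_cast hb₂ j)
  rw [volMin]
  linarith

theorem card_mul_card_sub_volTotal_le (a₁ a₂ : Fin n → ℤ) (hb₁ : ∀ j, 0 < b₁ j)
    (hb₂ : ∀ j, 0 < b₂ j) :
    (latticeBox a₁ b₁).card * (latticeBox a₂ b₂).card - volTotal b₁ b₂
      ≤ 2 ^ (2 * n) * (volTotal b₁ b₂ / volMin b₁ b₂) := by
  have hm := one_le_volMin hb₁ hb₂
  have h := prod_add_one_sub_prod_le (Finset.univ : Finset (Fin n ⊕ Fin n))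
    (y := Sum.elim (fun j => 2 * (b₁ j : ℝ)) fun j => 2 * (b₂ j : ℝ)) hm
    (by rintro (j | j) - <;> [exact (volMin_le j).1; exact (volMin_le j).2])
  simp only [Fintype.prod_sum_type, Sum.elim_inl, Sum.elim_inr, Finset.card_univ,
    Fintype.card_sum, Fintype.card_fin, ← vol_eq_prod, ← card_latticeBox a₁ fun j => (hb₁ j).le,
    ← card_latticeBox a₂ fun j => (hb₂ j).le, ← volTotal_eq_mul, ← two_mul] at h
  refine h.trans ?_
  have hV : 0 ≤ volTotal b₁ b₂ := by
    rw [volTotal_eq_mul]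
    exact mul_nonneg (vol_nonneg fun j => (hb₁ j).le) (vol_nonneg fun j => (hb₂ j).le)
  gcongr
  exact sub_le_self _ zero_le_one

theorem abs_sub_mul_volTotal_le {a₁ a₂ : Fin n → ℤ} (hb₁ : ∀ j, 0 < b₁ j) (hb₂ : ∀ j, 0 < b₂ j)
    {N p κ Q R : ℝ} (hp : 1 ≤ p) (hκ : 0 ≤ κ) (hQ : 0 ≤ Q)
    (h : |N - (latticeBox a₁ b₁).card * (latticeBox a₂ b₂).card * (p - 1)|
      ≤ κ * (((latticeBox a₁ b₁).card + (latticeBox a₂ b₂).card) * Q + R)) :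
    |N - (p - 1) * volTotal b₁ b₂|
      ≤ κ * (2 ^ n * (vol b₁ + vol b₂) * Q + R)
        + p * (2 ^ (2 * n) * (volTotal b₁ b₂ / volMin b₁ b₂)) := by
  have hX := vol_le_card_latticeBox a₁ fun j => (hb₁ j).le
  have hY := vol_le_card_latticeBox a₂ fun j => (hb₂ j).le
  have hV : volTotal b₁ b₂ ≤ (latticeBox a₁ b₁).card * (latticeBox a₂ b₂).card := by
    rw [volTotal_eq_mul]
    exact mul_le_mul hX hY (vol_nonneg fun j => (hb₂ j).le) (Nat.cast_nonneg _)
  refine (abs_sub_le _ _ _).trans (add_le_add (h.trans ?_) ?_)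
  · gcongr
    rw [mul_add]
    exact add_le_add (card_latticeBox_le a₁ hb₁) (card_latticeBox_le a₂ hb₂)
  · rw [mul_comm, ← mul_sub, abs_of_nonneg (mul_nonneg (by linarith) (sub_nonneg.mpr hV))]
    exact mul_le_mul (by linarith) (card_mul_card_sub_volTotal_le a₁ a₂ hb₁ hb₂)
      (sub_nonneg.mpr hV) (by linarith)

end Volumes

section DegreeOnePrimes

theorem ne_zero_of_six_mul_prod_notMem {R ι : Type*} [CommRing R] [Fintype ι] {γ : ι → R}
    {P : Ideal R} (h : 6 * ∏ j, γ j ∉ P) :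
    (2 : R ⧸ P) ≠ 0 ∧ (3 : R ⧸ P) ≠ 0 ∧ ∀ j, Ideal.Quotient.mk P (γ j) ≠ 0 := by
  have h0 : (2 : R ⧸ P) * 3 * ∏ j, Ideal.Quotient.mk P (γ j) ≠ 0 := by
    have h6 : Ideal.Quotient.mk P (6 * ∏ j, γ j) = 2 * 3 * ∏ j, Ideal.Quotient.mk P (γ j) := by
      rw [map_mul, map_prod, map_ofNat]
      norm_num
    rwa [← h6, Ne, Ideal.Quotient.eq_zero_iff_mem]
  have h23 := left_ne_zero_of_mul h0
  refine ⟨left_ne_zero_of_mul h23, right_ne_zero_of_mul h23, fun j hj => h0 ?_⟩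
  rw [Finset.prod_eq_zero (Finset.mem_univ j) hj, mul_zero]

theorem five_le_of_natCard_eq {R : Type*} [Ring R] {p : ℕ} (hp : p.Prime) (hcard : Nat.card R = p)
    (h2 : (2 : R) ≠ 0) (h3 : (3 : R) ≠ 0) : 5 ≤ p := by
  have hp0 : (p : R) = 0 := by
    have := Nat.finite_of_card_ne_zero (hcard ▸ hp.ne_zero)
    have := Fintype.ofFinite R
    rw [← hcard, Nat.card_eq_fintype_card, Nat.cast_card_eq_zero]
  by_contra! hlt
  have := hp.two_le
  interval_cases p
  · exact h2 (by exact_mod_cast hp0)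
  · exact h3 (by exact_mod_cast hp0)
  · exact absurd hp (by norm_num)

theorem isMaximal_of_liesOver_span_natCast {R : Type*} [CommRing R] [Algebra.IsIntegral ℤ R]
    (p : ℕ) [Fact p.Prime] (P : Ideal R) [P.IsPrime] [P.LiesOver (Ideal.span {(p : ℤ)})] :
    P.IsMaximal :=
  have := Int.ideal_span_isMaximal_of_prime p
  .of_liesOver_isMaximal P (Ideal.span {(p : ℤ)})

theorem natCard_quotient_eq_of_inertiaDeg_eq_one {K : Type*} [Field K] [NumberField K] (p : ℕ)
    [Fact p.Prime] (P : Ideal (𝓞 K)) [P.IsPrime] [P.LiesOver (Ideal.span {(p : ℤ)})]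
    (hf : P.inertiaDeg ℤ = 1) : Nat.card (𝓞 K ⧸ P) = p := by
  have := isMaximal_of_liesOver_span_natCast p P
  have h := Ideal.pow_inertiaDeg p P
  rw [hf, pow_one] at h
  rw [h, Ideal.absNorm_apply, Submodule.cardQuot_apply]

end DegreeOnePrimes

section ModelCountAsymptotics

open CurveBox

theorem abs_sub_div_mul_le {q A c v B r : ℝ} (hq : 0 < q) (hA : 1 ≤ A)
    (h : |q * (A * c) - r * v| ≤ B) : |c - r / (q * A) * v| ≤ B / q := by
  have hA0 : 0 < A := zero_lt_one.trans_le hA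
  calc |c - r / (q * A) * v| = |(q * (A * c) - r * v) / (q * A)| := by
        congr 1
        field_simp
    _ = |q * (A * c) - r * v| / (q * A) := by rw [abs_div, abs_of_pos (mul_pos hq hA0)]
    _ ≤ B / q := by
        gcongr
        · exact (abs_nonneg _).trans h
        · exact le_mul_of_one_le_right hq.le hA

theorem rpow_natCast_sub_three_halves {x : ℝ} (hx : 0 < x) (n : ℕ) :
    x ^ ((n : ℝ) - 3 / 2) = x ^ n * √x / x ^ 2 := by
  rw [show (n : ℝ) - 3 / 2 = n + 1 / 2 - (2 : ℕ) by push_cast; ring, Real.rpow_sub hx,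
    Real.rpow_add hx, Real.rpow_natCast, Real.rpow_natCast, ← Real.sqrt_eq_rpow]

theorem mul_add_mul_add_mul_le {r s t x y z : ℝ} (hr : 0 ≤ r) (hs : 0 ≤ s) (ht : 0 ≤ t)
    (hx : 0 ≤ x) (hy : 0 ≤ y) (hz : 0 ≤ z) :
    r * x + s * y + t * z ≤ (r + s + t) * (x + y + z) := by
  have : 0 ≤ r * (y + z) + s * (x + z) + t * (x + y) := by positivity
  linarith

variable {K : Type*} [Field K] [NumberField K]
  (γ : Module.Basis (Fin (Module.finrank ℚ K)) ℤ (𝓞 K))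

theorem exists_abs_autCount_mul_ncard_sub_le :
    ∃ κ : ℝ, 0 ≤ κ ∧ ∀ (p : ℕ) [Fact p.Prime] (P : Ideal (𝓞 K)) [P.IsMaximal],
      Nat.card (𝓞 K ⧸ P) = p → (2 : 𝓞 K ⧸ P) ≠ 0 → (3 : 𝓞 K ⧸ P) ≠ 0 →
      (∀ j, Ideal.Quotient.mk P (γ j) ≠ 0) →
      ∀ a b : 𝓞 K ⧸ P, (Module.finrank ℚ K = 1 → a * b ≠ 0) →
      ∀ a₁ b₁ a₂ b₂ : Fin (Module.finrank ℚ K) → ℤ,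
      |(p : ℝ) ^ 2 * (autCount (shortModel a b)
            * (modelsReducingTo γ a₁ b₁ a₂ b₂ P (shortModel a b)).ncard)
          - (latticeBox a₁ b₁).card * (latticeBox a₂ b₂).card * (p - 1)|
        ≤ κ * (((latticeBox a₁ b₁).card + (latticeBox a₂ b₂).card)
            * (p ^ Module.finrank ℚ K * √p * Real.log p ^ Module.finrank ℚ K)
          + p ^ (2 * Module.finrank ℚ K) * √p * Real.log p ^ (2 * Module.finrank ℚ K)) := by
  have : NeZero (Module.finrank ℚ K) := ⟨Module.finrank_pos.ne'⟩
  obtain ⟨κ, hκ, horbit⟩ := exists_abs_orbitBoxCount_sub_le γ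
  rw [Fintype.card_fin] at horbit
  refine ⟨κ, hκ, fun p _ P _ hcard h2 h3 hγ a b hab a₁ b₁ a₂ b₂ => ?_⟩
  have hp := (Fact.out : p.Prime)
  have := Nat.finite_of_card_ne_zero (hcard ▸ hp.ne_zero)
  have := Fintype.ofFinite (𝓞 K ⧸ P)
  have e : 𝓞 K ⧸ P ≃+* ZMod p :=
    (ZMod.ringEquivOfPrime (𝓞 K ⧸ P) hp (by rw [← Nat.card_eq_fintype_card, hcard])).symm
  rw [← Nat.cast_mul, autCount_mul_ncard_eq h2 h3 e]
  exact horbit p ((e : 𝓞 K ⧸ P →+* ZMod p).comp (Ideal.Quotient.mk P))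
    (five_le_of_natCard_eq hp hcard h2 h3) (fun j => (map_ne_zero_iff e e.injective).mpr (hγ j))
    (e a) (e b) (fun h1 => by simpa [← map_mul] using hab h1) a₁ b₁ a₂ b₂

theorem exists_abs_ncard_modelsReducingTo_sub_le :
    ∃ C : ℝ, ∀ (p : ℕ) [Fact p.Prime] (P : Ideal (𝓞 K)) [P.IsMaximal],
      Nat.card (𝓞 K ⧸ P) = p → (2 : 𝓞 K ⧸ P) ≠ 0 → (3 : 𝓞 K ⧸ P) ≠ 0 →
      (∀ j, Ideal.Quotient.mk P (γ j) ≠ 0) →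
      ∀ a b : 𝓞 K ⧸ P, (Module.finrank ℚ K = 1 → a * b ≠ 0) →
      ∀ a₁ b₁ a₂ b₂ : Fin (Module.finrank ℚ K) → ℤ, (∀ j, 0 < b₁ j) → (∀ j, 0 < b₂ j) →
      |((modelsReducingTo γ a₁ b₁ a₂ b₂ P (shortModel a b)).ncard : ℝ)
          - (p - 1) / (p ^ 2 * autCount (shortModel a b)) * volTotal b₁ b₂|
        ≤ C * (volTotal b₁ b₂ / (p * volMin b₁ b₂)
          + (vol b₁ + vol b₂) * (p : ℝ) ^ ((Module.finrank ℚ K : ℝ) - 3 / 2)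
            * Real.log p ^ Module.finrank ℚ K
          + (p : ℝ) ^ (2 * (Module.finrank ℚ K : ℝ) - 3 / 2)
            * Real.log p ^ (2 * Module.finrank ℚ K)) := by
  have : NeZero (Module.finrank ℚ K) := ⟨Module.finrank_pos.ne'⟩
  obtain ⟨κ, hκ, hcount⟩ := exists_abs_autCount_mul_ncard_sub_le γ
  set n := Module.finrank ℚ K
  refine ⟨2 ^ (2 * n) + κ * 2 ^ n + κ, ?_⟩
  intro p _ P _ hcard h2 h3 hγ a b hab a₁ b₁ a₂ b₂ hb₁ hb₂
  have hp1 : (1 : ℝ) ≤ p := by exact_mod_cast (Fact.out : p.Prime).one_le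
  have hp0 : (0 : ℝ) < p := zero_lt_one.trans_le hp1
  have haut : (1 : ℝ) ≤ autCount (shortModel a b) := by
    let := Ideal.Quotient.field P
    have : Finite (𝓞 K ⧸ P) := Nat.finite_of_card_ne_zero (by exact_mod_cast hcard ▸ hp0.ne')
    exact_mod_cast autCount_shortModel_pos h2 h3 a b
  have hnum := abs_sub_mul_volTotal_le hb₁ hb₂ hp1 hκ (by positivity)
    (hcount p P hcard h2 h3 hγ a b hab a₁ b₁ a₂ b₂)
  refine (abs_sub_div_mul_le (pow_pos hp0 2) haut hnum).trans ?_
  have hv : 0 ≤ vol b₁ := vol_nonneg fun j => (hb₁ j).le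
  have hw : 0 ≤ vol b₂ := vol_nonneg fun j => (hb₂ j).le
  have hm : 0 < volMin b₁ b₂ := zero_lt_one.trans_le (one_le_volMin hb₁ hb₂)
  have hexp : (p : ℝ) ^ (2 * (n : ℝ) - 3 / 2) = p ^ (2 * n) * √p / p ^ 2 := by
    exact_mod_cast rpow_natCast_sub_three_halves hp0 (2 * n)
  rw [rpow_natCast_sub_three_halves hp0, hexp, volTotal_eq_mul]
  refine le_trans (le_of_eq ?_) (mul_add_mul_add_mul_le (by positivity) (by positivity) hκ
    (by positivity) (by positivity) (by positivity))
  field_simp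
  ring

end ModelCountAsymptotics

theorem mainTheorem8_general (K : Type*) [Field K] [NumberField K]
    (γ : Module.Basis (Fin (Module.finrank ℚ K)) ℤ (𝓞 K)) :
    ∃ C : ℝ, ∀ (p : ℕ) (_ : p.Prime) (P : Ideal (𝓞 K)) (_ : P.IsPrime)
      (_ : P.LiesOver (Ideal.span {(p : ℤ)})) (_ : P.inertiaDeg ℤ = 1) (_ : 6 * ∏ j, γ j ∉ P)
      (a b : 𝓞 K ⧸ P),
      ((a * b ≠ 0 → CurveBox.autCount (CurveBox.shortModel a b) = 2) ∧
        (a ≠ 0 → b = 0 →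
          CurveBox.autCount (CurveBox.shortModel a b) = Nat.gcd 4 (p - 1)) ∧
        (a = 0 → b ≠ 0 →
          CurveBox.autCount (CurveBox.shortModel a b) = Nat.gcd 6 (p - 1))) ∧
      ((Module.finrank ℚ K = 1 → a * b ≠ 0) →
        ∀ a₁ b₁ a₂ b₂ : Fin (Module.finrank ℚ K) → ℤ,
          (∀ j, 0 < b₁ j) → (∀ j, 0 < b₂ j) →
          |((CurveBox.modelsReducingTo γ a₁ b₁ a₂ b₂ P
                (CurveBox.shortModel a b)).ncard : ℝ)
              - ((p : ℝ) - 1) /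
                  ((p : ℝ) ^ 2 * (CurveBox.autCount (CurveBox.shortModel a b) : ℝ))
                * CurveBox.volTotal b₁ b₂|
            ≤ C * (CurveBox.volTotal b₁ b₂ / ((p : ℝ) * CurveBox.volMin b₁ b₂)
                + (CurveBox.vol b₁ + CurveBox.vol b₂)
                    * (p : ℝ) ^ ((Module.finrank ℚ K : ℝ) - 3 / 2)
                    * Real.log p ^ Module.finrank ℚ K
                + (p : ℝ) ^ (2 * (Module.finrank ℚ K : ℝ) - 3 / 2)
                    * Real.log p ^ (2 * Module.finrank ℚ K))) := by
  obtain ⟨C, hC⟩ := exists_abs_ncard_modelsReducingTo_sub_le γ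
  refine ⟨C, fun p hp P _ _ hf hγ a b => ?_⟩
  have := Fact.mk hp
  have := isMaximal_of_liesOver_span_natCast p P
  have hcard := natCard_quotient_eq_of_inertiaDeg_eq_one p P hf
  obtain ⟨h2, h3, hγ'⟩ := ne_zero_of_six_mul_prod_notMem hγ
  refine ⟨?_, hC p P hcard h2 h3 hγ' a b⟩
  let := Ideal.Quotient.field P
  have : Finite (𝓞 K ⧸ P) := Nat.finite_of_card_ne_zero (hcard ▸ hp.ne_zero)
  refine ⟨autCount_eq_two h2 h3, ?_, ?_⟩
  · rintro ha rfl
    exact hcard ▸ autCount_eq_gcd_four h2 h3 ha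
  · rintro rfl hb
    exact hcard ▸ autCount_eq_gcd_six h2 h3 hb

theorem mainTheorem8 (K : Type*) [Field K] [NumberField K] [IsGalois ℚ K]
    (γ : Module.Basis (Fin (Module.finrank ℚ K)) ℤ (𝓞 K)) :
    ∃ C : ℝ, ∀ (p : ℕ) (_ : p.Prime) (P : Ideal (𝓞 K)) (_ : P.IsPrime)
      (_ : P.LiesOver (Ideal.span {(p : ℤ)}))
      (_ : P.inertiaDeg ℤ = 1)
      (_ : 6 * ∏ j, γ j ∉ P)
      (a b : 𝓞 K ⧸ P) (_ : (CurveBox.shortModel a b).IsElliptic),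
      -- the number of automorphisms of `E_{a,b}` over `𝓞 K ⧸ P`
      ((a * b ≠ 0 → CurveBox.autCount (CurveBox.shortModel a b) = 2) ∧
        (a ≠ 0 → b = 0 →
          CurveBox.autCount (CurveBox.shortModel a b) = Nat.gcd 4 (p - 1)) ∧
        (a = 0 → b ≠ 0 →
          CurveBox.autCount (CurveBox.shortModel a b) = Nat.gcd 6 (p - 1))) ∧
      -- the count of models; for `K = ℚ` the curves with `ab = 0` are excluded
      ((Module.finrank ℚ K = 1 → a * b ≠ 0) →
        ∀ a₁ b₁ a₂ b₂ : Fin (Module.finrank ℚ K) → ℤ,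
          (∀ j, 0 < b₁ j) → (∀ j, 0 < b₂ j) →
          |((CurveBox.modelsReducingTo γ a₁ b₁ a₂ b₂ P
                (CurveBox.shortModel a b)).ncard : ℝ)
              - ((p : ℝ) - 1) /
                  ((p : ℝ) ^ 2 * (CurveBox.autCount (CurveBox.shortModel a b) : ℝ))
                * CurveBox.volTotal b₁ b₂|
            ≤ C * (CurveBox.volTotal b₁ b₂ / ((p : ℝ) * CurveBox.volMin b₁ b₂)
                + (CurveBox.vol b₁ + CurveBox.vol b₂)
                    * (p : ℝ) ^ ((Module.finrank ℚ K : ℝ) - 3 / 2)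
                    * Real.log p ^ Module.finrank ℚ K
                + (p : ℝ) ^ (2 * (Module.finrank ℚ K : ℝ) - 3 / 2)
                    * Real.log p ^ (2 * Module.finrank ℚ K))) := by
  obtain ⟨C, hC⟩ := mainTheorem8_general K γ
  exact ⟨C, fun p hp P hP hover hf hγ a b _ => hC p hp P hP hover hf hγ a b⟩
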